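/- There are a function $f\colon\mathbb{N}^2\to\mathbb{N}$ and a constant $C$ with $f(k,t)\le C\,kt$ for all integers $k\ge 1$ and $t\ge 0$ (so $f(k,t)\in O(kt)$) such that, for all non-negative integers $k$ and $t$, every finite simple graph $G$ that contains the $f(k,t)\times f(k,t)$ grid as a minor either contains the complete graph $K_t$ as a minor or contains a planar induced subgraph of treewidth at least $k$. (The treewidth of a graph is the minimum, over its tree-decompositions, of the maximum size of a bag minus $1$; the graph without vertices has treewidth $-1$.) -/

import Mathlib

namespace SimpleGraph

universe u v

/-- `H` is a minor of `G`: there are pairwise disjoint connected (in particular non-empty) branch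
sets in `G`, one for each vertex of `H`, such that `G` has an edge between the branch sets of any
two adjacent vertices of `H`. -/
def IsMinor {W : Type u} {V : Type v} (H : SimpleGraph W) (G : SimpleGraph V) : Prop :=
  ∃ B : W → Set V,
    (∀ w, (G.induce (B w)).Connected) ∧
    (∀ w w', w ≠ w' → Disjoint (B w) (B w')) ∧
    (∀ w w', H.Adj w w' → ∃ x ∈ B w, ∃ y ∈ B w', G.Adj x y)

/-- The `m × n` grid. -/
def gridGraph (m n : ℕ) : SimpleGraph (Fin m × Fin n) :=
  (pathGraph m).boxProd (pathGraph n)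

/-- A tree-decomposition of `G`, over a finite tree. -/
structure TreeDecomposition {V : Type u} (G : SimpleGraph V) where
  /-- the nodes of the tree -/
  Node : Type
  [fintypeNode : Fintype Node]
  /-- the tree -/
  tree : SimpleGraph Node
  isTree : tree.IsTree
  /-- the bags -/
  bag : Node → Finset V
  edge_mem : ∀ v w, G.Adj v w → ∃ x, v ∈ bag x ∧ w ∈ bag x
  /-- the nodes whose bags contain `v` induce a non-empty subtree -/
  connected : ∀ v, (tree.induce {x | v ∈ bag x}).Connected

attribute [instance] TreeDecomposition.fintypeNode

/-- The width: the largest size of a bag, minus one. It is an integer: it equals `-1` if all bags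
are empty. -/
def TreeDecomposition.width {V : Type u} {G : SimpleGraph V} (D : TreeDecomposition G) : ℤ :=
  ((Finset.univ.sup fun x => (D.bag x).card : ℕ) : ℤ) - 1

/-- The treewidth of a finite graph: the minimum width of a tree-decomposition. -/
noncomputable def treewidth {V : Type u} (G : SimpleGraph V) : ℤ :=
  ⨅ D : TreeDecomposition G, D.width

/-- A finite graph has a tree-decomposition (with a single bag). -/
theorem nonempty_treeDecomposition {V : Type u} [Finite V] (G : SimpleGraph V) :
    Nonempty (TreeDecomposition G) := by
  have := Fintype.ofFinite V
  refine ⟨{ Node := Unit, tree := ⊥, isTree := IsTree.of_subsingleton,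
            bag := fun _ => Finset.univ, edge_mem := fun v w _ => ⟨(), by simp, by simp⟩,
            connected := fun v => ?_ }⟩
  have : Nonempty {x : Unit | v ∈ (Finset.univ : Finset V)} := ⟨⟨(), by simp⟩⟩
  exact { preconnected := fun a b => by rw [Subsingleton.elim a b] }

/-- Widths are bounded below, so the infimum defining the treewidth is a minimum. -/
theorem bddBelow_range_width {V : Type u} (G : SimpleGraph V) :
    BddBelow (Set.range fun D : TreeDecomposition G => D.width) := by
  refine ⟨-1, ?_⟩
  rintro _ ⟨D, rfl⟩
  simp only [TreeDecomposition.width]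
  omega

/-- `A` is a simple arc in the plane with the two ends `p` and `q`. -/
def IsSimpleArc (p q : ℝ × ℝ) (A : Set (ℝ × ℝ)) : Prop :=
  ∃ γ : _root_.Path p q, Function.Injective γ ∧ Set.range γ = A

/-- `G` is planar: it can be drawn in the plane with distinct points as vertices and simple arcs
as edges, such that an arc contains no vertex other than its two ends and any two different arcs
meet only in common ends. -/
def IsPlanar {V : Type u} (G : SimpleGraph V) : Prop :=
  ∃ (pos : V → ℝ × ℝ) (arc : Sym2 V → Set (ℝ × ℝ)),
    Function.Injective pos ∧
    (∀ v w, G.Adj v w → IsSimpleArc (pos v) (pos w) (arc s(v, w))) ∧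
    (∀ e ∈ G.edgeSet, ∀ v, pos v ∈ arc e → v ∈ e) ∧
    (∀ e ∈ G.edgeSet, ∀ e' ∈ G.edgeSet, e ≠ e' →
      ∀ p ∈ arc e ∩ arc e', ∃ v, v ∈ e ∧ v ∈ e' ∧ pos v = p)

end SimpleGraph

/-! The branch sets of the grid minor are recorded as integer coordinates `cx`, `cy` on the vertices
(`IsGridMap`). A grid of side t(6k+7) is cut into t × t squares of side 6k+6, separated by single
columns and rows. The question is whether every square contains two disjoint, touching, connected
sets, one crossing it from left to right and the other from bottom to top (`IsCrossing`).

If all squares do, the horizontal sets in the i-th row of squares are strung together, as are the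
vertical sets in the i-th column of squares, and the union of the two is the i-th branch set of a
complete minor. Row i and column j can interfere only in their common square, where for i ≠ j they
are disjoint but joined by an edge (`completeGraph_isMinor`).

If some square does not, no edge inside it jumps over a column or a row: the line jumped over, and
the two remaining parts joined by the edge, would be such a pair (`exists_isCrossing_of_jump`). So
edges in this square change each coordinate by at most one. It is then possible to choose induced
paths along k+1 rows, and k+1 induced connectors between consecutive rows, so far apart that
locality excludes all unwanted edges. The subgraph induced by this wall has an explicit
straight-line drawing (`WallShape`), although the end of a connector may have several neighbours on
a row. Its k+1 rows meet each of k+1 disjoint vertical connected sets. By the Helly property of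
subtrees some bag meets every union of a row and a vertical set, hence meets all rows or all
vertical sets and has at least k+1 elements (`le_treewidth_of_crossing`). -/

namespace SimpleGraph

/-! ### Connected vertex sets -/

variable {V W : Type*} {G : SimpleGraph V}

theorem induce_connected_iff {s : Set V} :
    (G.induce s).Connected ↔ s.Nonempty ∧ ∀ u ∈ s, ∀ v ∈ s,
      Relation.ReflTransGen (fun a b => G.Adj a b ∧ a ∈ s ∧ b ∈ s) u v := by
  constructor
  · intro h
    refine ⟨Set.nonempty_coe_sort.mp h.nonempty, fun u hu v hv => ?_⟩
    have := (reachable_iff_reflTransGen _ _).mp (h.preconnected ⟨u, hu⟩ ⟨v, hv⟩)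
    exact this.lift Subtype.val fun a b hab => ⟨hab, a.2, b.2⟩
  · rintro ⟨⟨w, hw⟩, h⟩
    have : Nonempty s := ⟨⟨w, hw⟩⟩
    refine ⟨fun u v => ?_⟩
    have key : ∀ y, Relation.ReflTransGen (fun a b => G.Adj a b ∧ a ∈ s ∧ b ∈ s) u.1 y →
        ∀ hy : y ∈ s, (G.induce s).Reachable u ⟨y, hy⟩ := by
      intro y hy
      induction hy with
      | refl => intro _; exact Reachable.refl _
      | tail _ hbc ih =>
        intro hc
        exact (ih hbc.2.1).trans (Adj.reachable (by simpa using hbc.1))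
    exact key v (h u u.2 v v.2) v.2

theorem induce_connected_of_base {s : Set V} (w : V) (hw : w ∈ s)
    (h : ∀ v ∈ s, Relation.ReflTransGen (fun a b => G.Adj a b ∧ a ∈ s ∧ b ∈ s) w v) :
    (G.induce s).Connected := by
  refine induce_connected_iff.mpr ⟨⟨w, hw⟩, fun u hu v hv => ?_⟩
  refine Relation.ReflTransGen.trans ?_ (h v hv)
  have := (h u hu).swap
  exact this.lift id fun a b hab => ⟨hab.1.symm, hab.2.2, hab.2.1⟩

theorem reflTransGen_mono_set {s t : Set V} (hst : s ⊆ t) {u v : V}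
    (h : Relation.ReflTransGen (fun a b => G.Adj a b ∧ a ∈ s ∧ b ∈ s) u v) :
    Relation.ReflTransGen (fun a b => G.Adj a b ∧ a ∈ t ∧ b ∈ t) u v :=
  h.lift id fun _ _ hab => ⟨hab.1, hst hab.2.1, hst hab.2.2⟩

/-- Two sets of vertices share a vertex or are joined by an edge. -/
def Touch (G : SimpleGraph V) (s t : Set V) : Prop := ∃ x ∈ s, ∃ y ∈ t, x = y ∨ G.Adj x y

theorem Touch.symm {s t : Set V} (h : G.Touch s t) : G.Touch t s := by
  obtain ⟨x, hx, y, hy, h⟩ := h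
  exact ⟨y, hy, x, hx, h.imp Eq.symm Adj.symm⟩

theorem Touch.mono {s t s' t' : Set V} (h : G.Touch s t) (hs : s ⊆ s') (ht : t ⊆ t') :
    G.Touch s' t' := by
  obtain ⟨x, hx, y, hy, h⟩ := h
  exact ⟨x, hs hx, y, ht hy, h⟩

theorem Touch.connected_union {s t : Set V} (hst : G.Touch s t) (hs : (G.induce s).Connected)
    (ht : (G.induce t).Connected) : (G.induce (s ∪ t)).Connected := by
  obtain ⟨x, hx, y, hy, h⟩ := hst
  refine induce_connected_of_base x (Or.inl hx) fun v hv => ?_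
  rcases hv with hv | hv
  · exact reflTransGen_mono_set Set.subset_union_left ((induce_connected_iff.mp hs).2 x hx v hv)
  · have h2 := reflTransGen_mono_set (Set.subset_union_right (s := s))
      ((induce_connected_iff.mp ht).2 y hy v hv)
    rcases h with rfl | h
    · exact h2
    · exact Relation.ReflTransGen.head ⟨h, Or.inl hx, Or.inr hy⟩ h2

/-- The union of a chain of connected sets, consecutive ones touching, is connected. -/
theorem connected_chain (s : ℤ → Set V) (a b : ℤ) (hab : a < b)
    (hs : ∀ i, a ≤ i → i < b → (G.induce (s i)).Connected)
    (ht : ∀ i, a ≤ i → i + 1 < b → G.Touch (s i) (s (i + 1))) :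
    (G.induce {v | ∃ i, a ≤ i ∧ i < b ∧ v ∈ s i}).Connected := by
  have key : ∀ n : ℕ, a + n < b →
      (G.induce {v | ∃ i, a ≤ i ∧ i ≤ a + n ∧ v ∈ s i}).Connected := by
    intro n
    induction n with
    | zero =>
      intro h
      have : {v | ∃ i, a ≤ i ∧ i ≤ a + (0 : ℕ) ∧ v ∈ s i} = s a := by
        ext v
        constructor
        · rintro ⟨i, h1, h2, h3⟩
          obtain rfl : i = a := by push_cast at h2; omega
          exact h3
        · intro hv
          exact ⟨a, le_rfl, by simp, hv⟩
      rw [this]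
      exact hs a le_rfl (by omega)
    | succ n ih =>
      intro h
      push_cast at h
      have hu : {v | ∃ i, a ≤ i ∧ i ≤ a + (n + 1 : ℕ) ∧ v ∈ s i} =
          {v | ∃ i, a ≤ i ∧ i ≤ a + n ∧ v ∈ s i} ∪ s (a + n + 1) := by
        ext v
        constructor
        · rintro ⟨i, h1, h2, h3⟩
          push_cast at h2
          by_cases h4 : i ≤ a + n
          · exact Or.inl ⟨i, h1, h4, h3⟩
          · obtain rfl : i = a + n + 1 := by omega
            exact Or.inr h3
        · rintro (⟨i, h1, h2, h3⟩ | h3)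
          · exact ⟨i, h1, by push_cast; omega, h3⟩
          · exact ⟨_, by omega, by push_cast; omega, h3⟩
      rw [hu]
      refine Touch.connected_union ?_ (ih (by omega)) (hs _ (by omega) (by omega))
      exact (ht (a + n) (by omega) (by omega)).mono
        (fun v hv => ⟨a + n, by omega, le_rfl, hv⟩) subset_rfl
  have hset : {v | ∃ i, a ≤ i ∧ i < b ∧ v ∈ s i} =
      {v | ∃ i, a ≤ i ∧ i ≤ a + (b - a - 1).toNat ∧ v ∈ s i} := by
    ext v
    constructor <;> rintro ⟨i, h1, h2, h3⟩ <;> exact ⟨i, h1, by omega, h3⟩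
  rw [hset]
  exact key _ (by omega)

/-! ### Subtrees, the Helly property and a lower bound on treewidth -/

section Tree

variable {T : SimpleGraph W}

/-- Parents are unique: geodesics from the root through two parents would be two different paths to
`z`. -/
theorem IsTree.eq_of_adj_of_dist (hT : T.IsTree) (r : W) {z y y' : W} (h : T.Adj y z)
    (h' : T.Adj y' z) (hd : T.dist r z = T.dist r y + 1) (hd' : T.dist r z = T.dist r y' + 1) :
    y = y' := by
  obtain ⟨p, hp⟩ := hT.connected.exists_walk_length_eq_dist r y
  obtain ⟨q, hq⟩ := hT.connected.exists_walk_length_eq_dist r y'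
  have h1 : (p.concat h).IsPath := Walk.isPath_of_length_eq_dist _ (by simp [hp, hd])
  have h2 : (q.concat h').IsPath := Walk.isPath_of_length_eq_dist _ (by simp [hq, hd'])
  have h3 : p.concat h = q.concat h' :=
    congrArg Subtype.val ((hT.isAcyclic.subsingleton_path r z).elim ⟨_, h1⟩ ⟨_, h2⟩)
  have := congrArg Walk.penultimate h3
  simpa using this

/-- In a rooted tree, a path whose first step leads away from the root goes away for ever. -/
theorem IsTree.dist_lt_of_isPath_cons (hT : T.IsTree) (r : W) {y t : W} (p : T.Walk y t) :
    ∀ {z : W} (h : T.Adj z y), (Walk.cons h p).IsPath → T.dist r y = T.dist r z + 1 →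
      T.dist r z < T.dist r t := by
  induction p with
  | nil => intro z h _ hd; omega
  | @cons y y₂ t h₂ p ih =>
    intro z h hp hd
    rcases hT.dist_eq_dist_add_one_of_adj r h₂ with h3 | h3
    · have : z = y₂ := hT.eq_of_adj_of_dist r h h₂.symm hd h3
      subst this
      simp [Walk.cons_isPath_iff] at hp
    · have := ih h₂ hp.of_cons h3
      omega

/-- A connected set in a rooted tree is closed under going to the parent, unless at its top. -/
theorem IsTree.exists_parent_mem (hT : T.IsTree) (r : W) {A : Set W}
    (hA : (T.induce A).Connected) {z t : W} (hz : z ∈ A) (ht : t ∈ A) (hzt : t ≠ z)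
    (hd : T.dist r t ≤ T.dist r z) : ∃ y ∈ A, T.Adj y z ∧ T.dist r z = T.dist r y + 1 := by
  obtain ⟨p, hp⟩ := (hA.preconnected ⟨z, hz⟩ ⟨t, ht⟩).exists_isPath
  cases p with
  | nil => exact absurd rfl hzt
  | @cons _ y _ h p =>
    have h' : T.Adj z y.1 := h
    rcases hT.dist_eq_dist_add_one_of_adj r h' with h3 | h3
    · exact ⟨y, y.2, h'.symm, h3⟩
    · have hp2 := hp.map (f := (Embedding.induce A).toHom)
        Subtype.val_injective
      have := hT.dist_lt_of_isPath_cons r (p.map (Embedding.induce A).toHom) h' hp2 h3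
      exact absurd this (by simpa using hd)

/-- The Helly property of subtrees. -/
theorem IsTree.helly [Finite W] (hT : T.IsTree) {ι : Type*} [Finite ι] (A : ι → Set W)
    (hA : ∀ i, (T.induce (A i)).Connected) (hAA : ∀ i j, (A i ∩ A j).Nonempty) :
    ∃ x, ∀ i, x ∈ A i := by
  obtain ⟨r⟩ := hT.connected.nonempty
  rcases isEmpty_or_nonempty ι with hι | hι
  · exact ⟨r, fun i => hι.elim i⟩
  have htop : ∀ i, ∃ t ∈ A i, ∀ x ∈ A i, T.dist r t ≤ T.dist r x := fun i =>
    (Set.toFinite (A i)).exists_minimalFor (T.dist r) _ ((hAA i i).mono Set.inter_subset_left)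
      |>.imp fun t ht => ⟨ht.1, fun x hx => (le_total _ _).elim id fun h => ht.2 hx h⟩
  choose t ht htmin using htop
  -- The subtree whose top is deepest: this top is the common node. Otherwise a highest node `z` of
  -- `A m ∩ A i` has its parent in `A m`. Then `z` is not the top of `A i`, being deeper than `t m`,
  -- so the parent lies in `A i` as well, against the choice of `z`.
  obtain ⟨m, hm⟩ := Finite.exists_max fun i => T.dist r (t i)
  refine ⟨t m, fun i => ?_⟩
  obtain ⟨z, hz, hzmin⟩ := (Set.toFinite (A m ∩ A i)).exists_minimalFor (T.dist r) _ (hAA m i)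
  by_cases hzt : t m = z
  · rw [hzt]; exact hz.2
  exfalso
  obtain ⟨y, hy, hyz, hyd⟩ := hT.exists_parent_mem r (hA m) hz.1 (ht m) hzt (htmin m z hz.1)
  by_cases hit : t i = z
  · have h1 := hm i
    have h2 := htmin m y hy
    simp only [hit] at h1
    omega
  · obtain ⟨y', hy', hyz', hyd'⟩ := hT.exists_parent_mem r (hA i) hz.2 (ht i) hit
      (htmin i z hz.2)
    obtain rfl := hT.eq_of_adj_of_dist r hyz hyz' hyd hyd'
    have := hzmin ⟨hy, hy'⟩ (by omega)
    omega

end Tree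

/-- Each edge inside `A` lies in a bag, so the subtrees of its two ends share a node; walking
through `A` links all the subtrees. -/
theorem TreeDecomposition.connected_nodes (D : TreeDecomposition G) {A : Set V}
    (hA : (G.induce A).Connected) : (D.tree.induce {x | ∃ v ∈ A, v ∈ D.bag x}).Connected := by
  obtain ⟨⟨w, hw⟩, hreach⟩ := induce_connected_iff.mp hA
  have hsub : ∀ v ∈ A, {x | v ∈ D.bag x} ⊆ {x | ∃ v ∈ A, v ∈ D.bag x} :=
    fun v hv x hx => ⟨v, hv, hx⟩
  obtain ⟨⟨x₀, hx₀⟩, -⟩ := induce_connected_iff.mp (D.connected w)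
  refine induce_connected_of_base x₀ ⟨w, hw, hx₀⟩ ?_
  have key : ∀ v, Relation.ReflTransGen (fun a b => G.Adj a b ∧ a ∈ A ∧ b ∈ A) w v → v ∈ A →
      ∀ x, v ∈ D.bag x → Relation.ReflTransGen (fun a b => D.tree.Adj a b ∧
        a ∈ {x | ∃ v ∈ A, v ∈ D.bag x} ∧ b ∈ {x | ∃ v ∈ A, v ∈ D.bag x}) x₀ x := by
    intro v hv
    induction hv with
    | refl =>
      intro _ x hx
      exact reflTransGen_mono_set (hsub w hw)
        ((induce_connected_iff.mp (D.connected w)).2 x₀ hx₀ x hx)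
    | @tail b c _ hbc ih =>
      intro hc x hx
      obtain ⟨y, hby, hcy⟩ := D.edge_mem b c hbc.1
      exact (ih hbc.2.1 y hby).trans (reflTransGen_mono_set (hsub c hc)
        ((induce_connected_iff.mp (D.connected c)).2 y hcy x hx))
  rintro x ⟨v, hv, hx⟩
  exact key v (hreach w hw v hv) hv x hx

theorem exists_disjoint_of_card_lt {n : ℕ} (R : Fin n → Set V)
    (hR : ∀ i j, i ≠ j → Disjoint (R i) (R j)) (s : Finset V) (hs : s.card < n) :
    ∃ i, ∀ v ∈ s, v ∉ R i := by
  by_contra! h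
  choose f hf hfR using h
  obtain ⟨i, -, j, -, hij, he⟩ := Finset.exists_ne_map_eq_of_card_lt_of_maps_to
    (s := Finset.univ) (t := s) (by simpa using hs) (f := f) (fun i _ => hf i)
  exact Set.disjoint_left.mp (hR i j hij) (hfR i) (he ▸ hfR j)

/-- Crossing families of `n` disjoint connected sets force treewidth at least `n - 1`. -/
theorem le_treewidth_of_crossing [Finite V] {n : ℕ} (R Z : Fin n → Set V)
    (hR : ∀ i, (G.induce (R i)).Connected) (hZ : ∀ i, (G.induce (Z i)).Connected)
    (hRd : ∀ i j, i ≠ j → Disjoint (R i) (R j)) (hZd : ∀ i j, i ≠ j → Disjoint (Z i) (Z j))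
    (hRZ : ∀ i j, (R i ∩ Z j).Nonempty) : (n : ℤ) - 1 ≤ G.treewidth := by
  have := nonempty_treeDecomposition G
  refine le_ciInf fun D => ?_
  -- The unions `R i ∪ Z j` are connected and pairwise intersecting, since `R i` meets `Z j'`; hence
  -- some bag meets all of them.
  obtain ⟨x, hx⟩ := D.isTree.helly
    (fun ij : Fin n × Fin n => {x | ∃ v ∈ R ij.1 ∪ Z ij.2, v ∈ D.bag x})
    (fun ij => D.connected_nodes (Touch.connected_union (by
      obtain ⟨v, hv1, hv2⟩ := hRZ ij.1 ij.2
      exact ⟨v, hv1, v, hv2, Or.inl rfl⟩) (hR _) (hZ _)))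
    (by
      rintro ⟨i, j⟩ ⟨i', j'⟩
      obtain ⟨v, hv1, hv2⟩ := hRZ i j'
      obtain ⟨⟨x, hx⟩, -⟩ := induce_connected_iff.mp (D.connected v)
      exact ⟨x, ⟨v, Or.inl hv1, hx⟩, ⟨v, Or.inr hv2, hx⟩⟩)
  have hn : n ≤ (D.bag x).card := by
    by_contra! hlt
    obtain ⟨i, hi⟩ := exists_disjoint_of_card_lt R hRd _ hlt
    obtain ⟨j, hj⟩ := exists_disjoint_of_card_lt Z hZd _ hlt
    obtain ⟨v, hv | hv, hvx⟩ := hx (i, j)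
    · exact hi v hvx hv
    · exact hj v hvx hv
  have : (D.bag x).card ≤ Finset.univ.sup fun x => (D.bag x).card :=
    Finset.le_sup (f := fun x => (D.bag x).card) (Finset.mem_univ x)
  simp only [TreeDecomposition.width]
  omega

theorem induce_induce_connected {S A : Set V} (hAS : A ⊆ S) (hA : (G.induce A).Connected) :
    ((G.induce S).induce (Subtype.val ⁻¹' A)).Connected := by
  obtain ⟨⟨w, hw⟩, h⟩ := induce_connected_iff.mp hA
  have : Nonempty (Subtype.val ⁻¹' A : Set S) := ⟨⟨⟨w, hAS hw⟩, hw⟩⟩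
  refine ⟨fun u v => ?_⟩
  have := hA.preconnected ⟨u.1.1, u.2⟩ ⟨v.1.1, v.2⟩
  exact this.map (G' := (G.induce S).induce (Subtype.val ⁻¹' A))
    ⟨fun a => ⟨⟨a.1, hAS a.2⟩, a.2⟩, fun h => h⟩

theorem le_treewidth_induce_of_crossing [Finite V] {n : ℕ} {S : Set V} (R Z : Fin n → Set V)
    (hRS : ∀ i, R i ⊆ S) (hZS : ∀ i, Z i ⊆ S)
    (hR : ∀ i, (G.induce (R i)).Connected) (hZ : ∀ i, (G.induce (Z i)).Connected)
    (hRd : ∀ i j, i ≠ j → Disjoint (R i) (R j)) (hZd : ∀ i j, i ≠ j → Disjoint (Z i) (Z j))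
    (hRZ : ∀ i j, (R i ∩ Z j).Nonempty) : (n : ℤ) - 1 ≤ (G.induce S).treewidth :=
  le_treewidth_of_crossing (fun i => Subtype.val ⁻¹' R i) (fun i => Subtype.val ⁻¹' Z i)
    (fun i => induce_induce_connected (hRS i) (hR i))
    (fun i => induce_induce_connected (hZS i) (hZ i))
    (fun i j h => (hRd i j h).preimage _) (fun i j h => (hZd i j h).preimage _)
    (fun i j => by
      obtain ⟨v, h1, h2⟩ := hRZ i j
      exact ⟨⟨v, hRS i h1⟩, h1, h2⟩)

end SimpleGraph

/-! ### Coordinates from a grid minor, crossings of squares and the complete minor -/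

namespace SimpleGraph

variable {V : Type*} {G : SimpleGraph V} {cx cy : V → ℤ}

/-- The vertices with coordinates in `[a, a') × [b, b')`. -/
def box (cx cy : V → ℤ) (a a' b b' : ℤ) : Set V :=
  {v | (a ≤ cx v ∧ cx v < a') ∧ b ≤ cy v ∧ cy v < b'}

/-- The vertices with coordinates `(x, y)`. -/
def cell (cx cy : V → ℤ) (x y : ℤ) : Set V := {v | cx v = x ∧ cy v = y}

/-- The fibres of the coordinates over `[0, N) × [0, N)` are the branch sets of a grid minor. -/
structure IsGridMap (G : SimpleGraph V) (cx cy : V → ℤ) (N : ℤ) : Prop where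
  connected : ∀ x y, 0 ≤ x → x < N → 0 ≤ y → y < N → (G.induce (cell cx cy x y)).Connected
  right : ∀ x y, 0 ≤ x → x + 1 < N → 0 ≤ y → y < N →
    G.Touch (cell cx cy x y) (cell cx cy (x + 1) y)
  up : ∀ x y, 0 ≤ x → x < N → 0 ≤ y → y + 1 < N →
    G.Touch (cell cx cy x y) (cell cx cy x (y + 1))

theorem cell_swap (x y : ℤ) : cell cy cx y x = cell cx cy x y := by
  ext v; simp [cell, and_comm]

theorem box_swap (a a' b b' : ℤ) : box cy cx b b' a a' = box cx cy a a' b b' := by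
  ext v; simp [box, and_comm]

theorem IsGridMap.swap {N : ℤ} (h : IsGridMap G cx cy N) : IsGridMap G cy cx N where
  connected x y h1 h2 h3 h4 := by rw [cell_swap]; exact h.connected y x h3 h4 h1 h2
  right x y h1 h2 h3 h4 := by rw [← cell_swap, ← cell_swap (cx := cy)]; exact h.up y x h3 h4 h1 h2
  up x y h1 h2 h3 h4 := by rw [← cell_swap, ← cell_swap (cx := cy)]; exact h.right y x h3 h4 h1 h2

theorem cell_subset_box {a a' b b' x y : ℤ} (h1 : a ≤ x) (h2 : x < a') (h3 : b ≤ y)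
    (h4 : y < b') : cell cx cy x y ⊆ box cx cy a a' b b' := by
  rintro v ⟨rfl, rfl⟩
  exact ⟨⟨h1, h2⟩, h3, h4⟩

theorem IsGridMap.touch_right {N : ℤ} (h : IsGridMap G cx cy N) {s t : Set V} (x y : ℤ)
    (h1 : 0 ≤ x) (h2 : x + 1 < N) (h3 : 0 ≤ y) (h4 : y < N)
    (hs : cell cx cy x y ⊆ s) (ht : cell cx cy (x + 1) y ⊆ t) : G.Touch s t :=
  (h.right x y h1 h2 h3 h4).mono hs ht

theorem IsGridMap.box_connected {N : ℤ} (h : IsGridMap G cx cy N) {a a' b b' : ℤ}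
    (ha : 0 ≤ a) (haa : a < a') (ha' : a' ≤ N) (hb : 0 ≤ b) (hbb : b < b') (hb' : b' ≤ N) :
    (G.induce (box cx cy a a' b b')).Connected := by
  have hrow : ∀ y, b ≤ y → y < b' →
      (G.induce {v | ∃ x, a ≤ x ∧ x < a' ∧ v ∈ cell cx cy x y}).Connected := fun y hy hy' =>
    connected_chain _ a a' haa
      (fun x hx hx' => h.connected x y (by omega) (by omega) (by omega) (by omega))
      (fun x hx hx' => h.right x y (by omega) (by omega) (by omega) (by omega))
  have := connected_chain (G := G) (fun y => {v | ∃ x, a ≤ x ∧ x < a' ∧ v ∈ cell cx cy x y})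
    b b' hbb hrow fun y hy hy' =>
      (h.up a y (by omega) (by omega) (by omega) (by omega)).mono
        (fun v hv => ⟨a, le_rfl, haa, hv⟩) (fun v hv => ⟨a, le_rfl, haa, hv⟩)
  convert this using 2
  all_goals
    ext v
    constructor
    · rintro ⟨⟨h1, h2⟩, h3, h4⟩
      exact ⟨cy v, h3, h4, cx v, h1, h2, rfl, rfl⟩
    · rintro ⟨y, h1, h2, x, h3, h4, rfl, rfl⟩
      exact ⟨⟨h3, h4⟩, h1, h2⟩

/-- `X` and `Y` cross the square of side `M` at `(a, b)` from left to right and from bottom to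
top. -/
structure IsCrossing (G : SimpleGraph V) (cx cy : V → ℤ) (M a b : ℤ) (X Y : Set V) : Prop where
  subset_left : X ⊆ box cx cy a (a + M) b (b + M)
  subset_right : Y ⊆ box cx cy a (a + M) b (b + M)
  connected_left : (G.induce X).Connected
  connected_right : (G.induce Y).Connected
  touch : G.Touch X Y
  left : ∃ y, b ≤ y ∧ y < b + M ∧ cell cx cy a y ⊆ X
  right : ∃ y, b ≤ y ∧ y < b + M ∧ cell cx cy (a + M - 1) y ⊆ X
  bot : ∃ x, a ≤ x ∧ x < a + M ∧ cell cx cy x b ⊆ Y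
  top : ∃ x, a ≤ x ∧ x < a + M ∧ cell cx cy x (b + M - 1) ⊆ Y

theorem IsCrossing.swap {M a b : ℤ} {X Y : Set V} (h : IsCrossing G cy cx M b a X Y) :
    IsCrossing G cx cy M a b Y X where
  subset_left := by rw [← box_swap]; exact h.subset_right
  subset_right := by rw [← box_swap]; exact h.subset_left
  connected_left := h.connected_right
  connected_right := h.connected_left
  touch := h.touch.symm
  left := by simp_rw [← cell_swap (cx := cx)]; exact h.bot
  right := by simp_rw [← cell_swap (cx := cx)]; exact h.top
  bot := by simp_rw [← cell_swap (cx := cx)]; exact h.left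
  top := by simp_rw [← cell_swap (cx := cx)]; exact h.right

theorem IsGridMap.isCrossing_box {N : ℤ} (h : IsGridMap G cx cy N) {M a b : ℤ} (hM : 0 < M)
    (ha : 0 ≤ a) (ha' : a + M ≤ N) (hb : 0 ≤ b) (hb' : b + M ≤ N) :
    IsCrossing G cx cy M a b (box cx cy a (a + M) b (b + M)) (box cx cy a (a + M) b (b + M)) := by
  have hc := h.box_connected ha (by omega : a < a + M) ha' hb (by omega : b < b + M) hb'
  refine ⟨subset_rfl, subset_rfl, hc, hc, ?_, ?_, ?_, ?_, ?_⟩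
  · obtain ⟨⟨v, hv⟩⟩ := hc.nonempty
    exact ⟨v, hv, v, hv, Or.inl rfl⟩
  · exact ⟨b, by omega, by omega, cell_subset_box (by omega) (by omega) (by omega) (by omega)⟩
  · exact ⟨b, by omega, by omega, cell_subset_box (by omega) (by omega) (by omega) (by omega)⟩
  · exact ⟨a, by omega, by omega, cell_subset_box (by omega) (by omega) (by omega) (by omega)⟩
  · exact ⟨a, by omega, by omega, cell_subset_box (by omega) (by omega) (by omega) (by omega)⟩

/-- An edge jumping over a column of a square leads to two disjoint crossing sets. -/
theorem IsGridMap.exists_isCrossing_of_jump {N : ℤ} (h : IsGridMap G cx cy N) {M a b : ℤ}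
    (ha : 0 ≤ a) (ha' : a + M ≤ N) (hb : 0 ≤ b) (hb' : b + M ≤ N) {u v : V} (huv : G.Adj u v)
    (hu : u ∈ box cx cy a (a + M) b (b + M)) (hv : v ∈ box cx cy a (a + M) b (b + M))
    (hj : cx u + 2 ≤ cx v) : ∃ X Y, IsCrossing G cx cy M a b X Y ∧ Disjoint X Y := by
  obtain ⟨⟨h1, h2⟩, h3, h4⟩ := hu
  obtain ⟨⟨h5, h6⟩, h7, h8⟩ := hv
  have hl := h.box_connected ha (by omega : a < cx u + 1) (by omega) hb (by omega : b < b + M) hb'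
  have hm := h.box_connected (by omega) (by omega : cx u + 1 < cx u + 2) (by omega) hb
    (by omega : b < b + M) hb'
  have hr := h.box_connected (by omega) (by omega : cx u + 2 < a + M) ha' hb
    (by omega : b < b + M) hb'
  -- `Y` is the column just right of `u`; `X` is the rest of the square, whose two halves are
  -- connected through the edge `u v`.
  refine ⟨box cx cy a (cx u + 1) b (b + M) ∪ box cx cy (cx u + 2) (a + M) b (b + M),
    box cx cy (cx u + 1) (cx u + 2) b (b + M), ⟨?_, ?_, ?_, hm, ?_, ?_, ?_, ?_, ?_⟩, ?_⟩
  · rintro w (⟨⟨_, _⟩, _, _⟩ | ⟨⟨_, _⟩, _, _⟩) <;> refine ⟨⟨?_, ?_⟩, ?_, ?_⟩ <;> omega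
  · rintro w ⟨⟨_, _⟩, _, _⟩; refine ⟨⟨?_, ?_⟩, ?_, ?_⟩ <;> omega
  · refine Touch.connected_union ⟨u, ?_, v, ?_, Or.inr huv⟩ hl hr
    · exact ⟨⟨h1, by omega⟩, h3, h4⟩
    · exact ⟨⟨hj, h6⟩, h7, h8⟩
  · exact h.touch_right (cx u) b (by omega) (by omega) hb (by omega)
      (Set.subset_union_of_subset_left
        (cell_subset_box h1 (by omega) (by omega) (by omega)) _)
      (cell_subset_box (by omega) (by omega) (by omega) (by omega))
  · exact ⟨b, by omega, by omega, Set.subset_union_of_subset_left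
      (cell_subset_box (by omega) (by omega) (by omega) (by omega)) _⟩
  · exact ⟨b, by omega, by omega, Set.subset_union_of_subset_right
      (cell_subset_box (by omega) (by omega) (by omega) (by omega)) _⟩
  · exact ⟨cx u + 1, by omega, by omega, cell_subset_box (by omega) (by omega) (by omega)
      (by omega)⟩
  · exact ⟨cx u + 1, by omega, by omega, cell_subset_box (by omega) (by omega) (by omega)
      (by omega)⟩
  · rw [Set.disjoint_left]
    rintro w (⟨⟨_, _⟩, _, _⟩ | ⟨⟨_, _⟩, _, _⟩) ⟨⟨_, _⟩, _, _⟩ <;> omega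

/-- A row of sets from left to right, linked by the columns between the squares. -/
def linkedRow (cx cy : V → ℤ) (M t i : ℤ) (X : ℤ → Set V) : Set V :=
  {v | ∃ j, 0 ≤ j ∧ j < t ∧
    v ∈ X j ∪ box cx cy (j * (M + 1) + M) (j * (M + 1) + M + 1) (i * (M + 1)) (i * (M + 1) + M)}

theorem IsGridMap.linkedRow_connected {M t : ℤ} (h : IsGridMap G cx cy (t * (M + 1)))
    (hM : 0 < M) {i : ℤ} (hi : 0 ≤ i) (hit : i < t) {X : ℤ → Set V}
    (hX : ∀ j, 0 ≤ j → j < t → (G.induce (X j)).Connected)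
    (hleft : ∀ j, 0 ≤ j → j < t →
      ∃ y, i * (M + 1) ≤ y ∧ y < i * (M + 1) + M ∧ cell cx cy (j * (M + 1)) y ⊆ X j)
    (hright : ∀ j, 0 ≤ j → j < t →
      ∃ y, i * (M + 1) ≤ y ∧ y < i * (M + 1) + M ∧ cell cx cy (j * (M + 1) + M - 1) y ⊆ X j) :
    (G.induce (linkedRow cx cy M t i X)).Connected := by
  have hle : ∀ j, j < t → j * (M + 1) + (M + 1) ≤ t * (M + 1) := fun j hj => by nlinarith
  have hpos : ∀ j, 0 ≤ j → 0 ≤ j * (M + 1) := fun j hj => by positivity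
  have hi1 := hle i hit
  have hi2 := hpos i hi
  refine connected_chain _ 0 t (by omega) (fun j hj hjt => ?_) (fun j hj hjt => ?_)
  · have hj1 := hle j hjt
    have hj2 := hpos j hj
    obtain ⟨y, hy1, hy2, hy⟩ := hright j hj hjt
    refine Touch.connected_union ?_ (hX j hj hjt) (h.box_connected (by omega) (by omega)
      (by omega) (by omega) (by omega) (by omega))
    exact h.touch_right (j * (M + 1) + M - 1) y (by omega) (by omega) (by omega) (by omega) hy
      (cell_subset_box (by omega) (by omega) (by omega) (by omega))
  · have hj1 := hle (j + 1) hjt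
    have hj2 := hpos j hj
    have hj3 : (j + 1) * (M + 1) = j * (M + 1) + M + 1 := by ring
    obtain ⟨y, hy1, hy2, hy⟩ := hleft (j + 1) (by omega) hjt
    refine h.touch_right (j * (M + 1) + M) y (by omega) (by omega) (by omega) (by omega)
      (Set.subset_union_of_subset_right
        (cell_subset_box (by omega) (by omega) (by omega) (by omega)) _)
      (Set.subset_union_of_subset_left ?_ _)
    rwa [hj3] at hy

/-- Squares repeat with period M + 1, and the links occupy exactly the residue M of `cx`. So a
vertex of the row whose column belongs to a square comes from the set chosen in that square. -/
theorem mem_linkedRow {M t i : ℤ} {X : ℤ → Set V} {v : V}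
    (hX : ∀ j, 0 ≤ j → j < t → X j ⊆ box cx cy (j * (M + 1)) (j * (M + 1) + M)
      (i * (M + 1)) (i * (M + 1) + M)) (hM : 0 < M) (hv : v ∈ linkedRow cx cy M t i X) :
    (i * (M + 1) ≤ cy v ∧ cy v < i * (M + 1) + M) ∧ 
      ∀ j, j * (M + 1) ≤ cx v → cx v < j * (M + 1) + M → v ∈ X j := by
  obtain ⟨j, hj, hjt, hv⟩ := hv
  constructor
  · rcases hv with hv | hv
    · exact (hX j hj hjt hv).2
    · exact hv.2
  · intro j' h1 h2
    have huniq : j * (M + 1) ≤ cx v → cx v < j * (M + 1) + (M + 1) → j' = j := by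
      intro h3 h4
      have h5 : cx v / (M + 1) = j := by
        rw [Int.ediv_eq_iff_of_pos (by omega)]; constructor <;> nlinarith
      have h6 : cx v / (M + 1) = j' := by
        rw [Int.ediv_eq_iff_of_pos (by omega)]; constructor <;> nlinarith
      omega
    rcases hv with hv | hv
    · obtain ⟨⟨h3, h4⟩, -⟩ := hX j hj hjt hv
      rwa [huniq h3 (by omega)]
    · obtain ⟨⟨h3, h4⟩, -⟩ := hv
      obtain rfl := huniq (by omega) (by omega)
      omega

/-- Branch set i is row i together with column i. Links of rows lie in separating columns and links
of columns in separating rows, so neither kind meets the other or any square. -/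
theorem IsGridMap.completeGraph_isMinor {t : ℕ} {M : ℤ}
    (h : IsGridMap G cx cy (t * (M + 1))) (hM : 0 < M)
    (hcross : ∀ i j : ℤ, 0 ≤ i → i < t → 0 ≤ j → j < t →
      ∃ X Y, IsCrossing G cx cy M (j * (M + 1)) (i * (M + 1)) X Y ∧ Disjoint X Y) :
    (completeGraph (Fin t)).IsMinor G := by
  have hall : ∀ i j : ℤ, ∃ X Y, 0 ≤ i → i < t → 0 ≤ j → j < t →
      IsCrossing G cx cy M (j * (M + 1)) (i * (M + 1)) X Y ∧ (i ≠ j → Disjoint X Y) := by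
    intro i j
    -- On the diagonal the row and the column belong to the same branch set, so the whole square may
    -- serve for both.
    by_cases hij : i = j
    · subst hij
      refine ⟨_, _, fun h1 h2 _ _ => ⟨h.isCrossing_box hM ?_ ?_ ?_ ?_, fun h => absurd rfl h⟩⟩ <;> nlinarith
    · by_cases hr : 0 ≤ i ∧ i < t ∧ 0 ≤ j ∧ j < t
      · obtain ⟨X, Y, h1, h2⟩ := hcross i j hr.1 hr.2.1 hr.2.2.1 hr.2.2.2
        exact ⟨X, Y, fun _ _ _ _ => ⟨h1, fun _ => h2⟩⟩
      · exact ⟨∅, ∅, fun h1 h2 h3 h4 => absurd ⟨h1, h2, h3, h4⟩ hr⟩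
  choose X Y hXY using hall
  have hrowX : ∀ i : ℤ, 0 ≤ i → i < t → ∀ j : ℤ, 0 ≤ j → j < t →
      X i j ⊆ box cx cy (j * (M + 1)) (j * (M + 1) + M) (i * (M + 1)) (i * (M + 1) + M) :=
    fun i h1 h2 j h3 h4 => (hXY i j h1 h2 h3 h4).1.subset_left
  have hcolY : ∀ j : ℤ, 0 ≤ j → j < t → ∀ i : ℤ, 0 ≤ i → i < t →
      Y i j ⊆ box cy cx (i * (M + 1)) (i * (M + 1) + M) (j * (M + 1)) (j * (M + 1) + M) :=
    fun j h3 h4 i h1 h2 => by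
      rw [box_swap]; exact (hXY i j h1 h2 h3 h4).1.subset_right
  have hXsub : ∀ i j : ℤ, 0 ≤ j → j < t → X i j ⊆ linkedRow cx cy M t i (X i) :=
    fun i j h1 h2 v hv => ⟨j, h1, h2, Or.inl hv⟩
  have hYsub : ∀ i j : ℤ, 0 ≤ i → i < t → Y i j ⊆ linkedRow cy cx M t j (fun i => Y i j) :=
    fun i j h1 h2 v hv => ⟨i, h1, h2, Or.inl hv⟩
  have key : ∀ i j : ℤ, 0 ≤ i → i < t → 0 ≤ j → j < t → i ≠ j →
      Disjoint (linkedRow cx cy M t i (X i)) (linkedRow cy cx M t j (fun i => Y i j)) := by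
    intro i j h1 h2 h3 h4 hij
    rw [Set.disjoint_left]
    intro v hv hv'
    obtain ⟨⟨h5, h6⟩, h7⟩ := mem_linkedRow (hrowX i h1 h2) hM hv
    obtain ⟨⟨h8, h9⟩, h10⟩ := mem_linkedRow (hcolY j h3 h4) hM hv'
    exact Set.disjoint_left.mp ((hXY i j h1 h2 h3 h4).2 hij) (h7 j h8 h9) (h10 i h5 h6)
  have hpar : ∀ i j z : ℤ, i * (M + 1) ≤ z → z < i * (M + 1) + M → j * (M + 1) ≤ z →
      z < j * (M + 1) + M → i = j := by
    intro i j z h1 h2 h3 h4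
    have h5 : z / (M + 1) = j := by
      rw [Int.ediv_eq_iff_of_pos (by omega)]; constructor <;> nlinarith
    have h6 : z / (M + 1) = i := by
      rw [Int.ediv_eq_iff_of_pos (by omega)]; constructor <;> nlinarith
    omega
  refine ⟨fun i => linkedRow cx cy M t i (X i) ∪ linkedRow cy cx M t i (fun i' => Y i' i),
    fun i => ?_, fun i j hij => ?_, fun i j hij => ?_⟩
  · have h1 : (0 : ℤ) ≤ i.1 := by omega
    have h2 : (i.1 : ℤ) < t := by exact_mod_cast i.2
    refine Touch.connected_union ?_ ?_ ?_
    · exact (hXY i i h1 h2 h1 h2).1.touch.mono (hXsub i i h1 h2) (hYsub i i h1 h2)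
    · exact h.linkedRow_connected hM h1 h2
        (fun j h3 h4 => (hXY i j h1 h2 h3 h4).1.connected_left)
        (fun j h3 h4 => (hXY i j h1 h2 h3 h4).1.left)
        (fun j h3 h4 => (hXY i j h1 h2 h3 h4).1.right)
    · refine h.swap.linkedRow_connected hM h1 h2
        (fun j h3 h4 => (hXY j i h3 h4 h1 h2).1.connected_right)
        (fun j h3 h4 => ?_) (fun j h3 h4 => ?_)
      · simp_rw [cell_swap (cx := cx)]; exact (hXY j i h3 h4 h1 h2).1.bot
      · simp_rw [cell_swap (cx := cx)]; exact (hXY j i h3 h4 h1 h2).1.top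
  · have h1 : (0 : ℤ) ≤ i.1 := by omega
    have h2 : (i.1 : ℤ) < t := by exact_mod_cast i.2
    have h3 : (0 : ℤ) ≤ j.1 := by omega
    have h4 : (j.1 : ℤ) < t := by exact_mod_cast j.2
    have hij' : (i.1 : ℤ) ≠ j.1 := by exact_mod_cast Fin.val_ne_of_ne hij
    rw [Set.disjoint_union_left, Set.disjoint_union_right, Set.disjoint_union_right]
    refine ⟨⟨?_, key i j h1 h2 h3 h4 hij'⟩, (key j i h3 h4 h1 h2 hij'.symm).symm, ?_⟩
    · rw [Set.disjoint_left]
      intro v hv hv'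
      have h5 := (mem_linkedRow (hrowX i h1 h2) hM hv).1
      have h6 := (mem_linkedRow (hrowX j h3 h4) hM hv').1
      exact hij' (hpar _ _ _ h5.1 h5.2 h6.1 h6.2)
    · rw [Set.disjoint_left]
      intro v hv hv'
      have h5 := (mem_linkedRow (hcolY i h1 h2) hM hv).1
      have h6 := (mem_linkedRow (hcolY j h3 h4) hM hv').1
      exact hij' (hpar _ _ _ h5.1 h5.2 h6.1 h6.2)
  · have h1 : (0 : ℤ) ≤ i.1 := by omega
    have h2 : (i.1 : ℤ) < t := by exact_mod_cast i.2
    have h3 : (0 : ℤ) ≤ j.1 := by omega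
    have h4 : (j.1 : ℤ) < t := by exact_mod_cast j.2
    have hij' : (i.1 : ℤ) ≠ j.1 := by exact_mod_cast Fin.val_ne_of_ne hij.ne
    obtain ⟨x, hx, y, hy, hxy⟩ := (hXY i j h1 h2 h3 h4).1.touch
    -- Disjointness excludes a shared vertex, so touching means an actual edge.
    have hxy' : x ≠ y := by
      rintro rfl
      exact Set.disjoint_left.mp ((hXY i j h1 h2 h3 h4).2 hij') hx hy
    exact ⟨x, Or.inl (hXsub i j h3 h4 hx), y, Or.inr (hYsub i j h1 h2 hy),
      hxy.resolve_left hxy'⟩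

end SimpleGraph

/-! ### Straight-line drawings of walls -/

namespace SimpleGraph

theorem isSimpleArc_segment {p q : ℝ × ℝ} (h : p ≠ q) : IsSimpleArc p q (segment ℝ p q) := by
  refine ⟨⟨⟨fun t => AffineMap.lineMap p q (t : ℝ), ?_⟩, by simp, by simp⟩, ?_, ?_⟩
  · exact (AffineMap.lineMap_continuous (R := ℝ)).comp continuous_subtype_val
  · intro s t hst
    exact Subtype.ext (AffineMap.lineMap_injective ℝ h hst)
  · rw [segment_eq_image_lineMap]
    ext z
    constructor
    · rintro ⟨t, rfl⟩
      exact ⟨t, t.2, rfl⟩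
    · rintro ⟨t, ht, rfl⟩
      exact ⟨⟨t, ht⟩, rfl⟩

/-- A straight-line drawing without crossings. -/
theorem isPlanar_of_openSegment {W : Type*} (H : SimpleGraph W) (pos : W → ℝ × ℝ)
    (hpos : Function.Injective pos) (E : W → W → Prop) (hE : ∀ v w, H.Adj v w → E v w ∨ E w v)
    (hvertex : ∀ u v w, E v w → pos u ∉ openSegment ℝ (pos v) (pos w))
    (hedge : ∀ v w v' w' z, E v w → E v' w' → z ∈ openSegment ℝ (pos v) (pos w) →
      z ∈ openSegment ℝ (pos v') (pos w') → v = v' ∧ w = w') : H.IsPlanar := by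
  have hseg : ∀ v w z, H.Adj v w → z ∈ segment ℝ (pos v) (pos w) →
      (∃ u ∈ s(v, w), pos u = z) ∨
        ∃ v' w', s(v, w) = s(v', w') ∧ E v' w' ∧ z ∈ openSegment ℝ (pos v') (pos w') := by
    intro v w z h hz
    rw [← insert_endpoints_openSegment] at hz
    rcases hz with rfl | rfl | hz
    · exact Or.inl ⟨v, by simp, rfl⟩
    · exact Or.inl ⟨w, by simp, rfl⟩
    · rcases hE v w h with h' | h'
      · exact Or.inr ⟨v, w, rfl, h', hz⟩
      · exact Or.inr ⟨w, v, Sym2.eq_swap, h', by rwa [openSegment_symm]⟩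
  have hvert : ∀ e ∈ H.edgeSet, ∀ v, pos v ∈ Sym2.lift ⟨fun v w => segment ℝ (pos v) (pos w),
      fun v w => segment_symm ℝ _ _⟩ e → v ∈ e := by
    intro e he u hu
    induction e with
    | _ v w =>
      rcases hseg v w _ he hu with ⟨u', hu', h⟩ | ⟨v', w', -, h1, h2⟩
      · rwa [← hpos h]
      · exact absurd h2 (hvertex u v' w' h1)
  refine ⟨pos, Sym2.lift ⟨fun v w => segment ℝ (pos v) (pos w), fun v w => segment_symm ℝ _ _⟩,
    hpos, fun v w h => isSimpleArc_segment (hpos.ne h.ne), hvert, ?_⟩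
  intro e he e' he' hee z hz
  have hz' := hz
  induction e with
  | _ v w =>
    induction e' with
    | _ v' w' =>
      rcases hseg v w z he hz.1 with ⟨u, hu, rfl⟩ | ⟨a, b, hab, h1, h2⟩
      · exact ⟨u, hu, hvert _ he' u hz'.2, rfl⟩
      · rcases hseg v' w' z he' hz.2 with ⟨u, hu, rfl⟩ | ⟨a', b', hab', h1', h2'⟩
        · exact ⟨u, hvert _ he u hz'.1, hu, rfl⟩
        · obtain ⟨rfl, rfl⟩ := hedge a b a' b' z h1 h1' h2 h2'
          exact absurd (hab.trans hab'.symm) hee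

/-- The combinatorial data of a drawing of a wall: row `r` has vertices `0, …, n r` in the columns
`x r i`, and the `j`-th connector from row `r` to row `r + 1` has vertices `0, …, m r j`, in the
column `c r j`. -/
structure WallShape where
  n : ℕ → ℕ
  m : ℕ → ℕ → ℕ
  x : ℕ → ℕ → ℤ
  c : ℕ → ℕ → ℤ
  x_mono : ∀ r i j, i ≤ j → j ≤ n r → x r i ≤ x r j
  c_sep : ∀ r j j', j < j' → c r j + 3 ≤ c r j'

namespace WallShape

variable (w : WallShape)

/-- The abscissa of a vertex in a row. -/
noncomputable def xpos (r i : ℕ) : ℝ := w.x r i + i / (w.n r + 1)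

/-- The position of a vertex in a row. -/
noncomputable def rowPt (r i : ℕ) : ℝ × ℝ := (w.xpos r i, r)

/-- The position of a vertex in a connector. -/
noncomputable def colPt (r j s : ℕ) : ℝ × ℝ := (w.c r j + 1 / 2, r + (s + 1) / (w.m r j + 2))

/-- The positions of vertices. -/
inductive IsVertex : ℝ × ℝ → Prop
  | row (r i : ℕ) : i ≤ w.n r → IsVertex (w.rowPt r i)
  | col (r j s : ℕ) : s ≤ w.m r j → IsVertex (w.colPt r j s)

/-- The positions of the ends of edges. -/
inductive IsEdge : ℝ × ℝ → ℝ × ℝ → Prop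
  | row (r i : ℕ) : i + 1 ≤ w.n r → IsEdge (w.rowPt r i) (w.rowPt r (i + 1))
  | low (r j i : ℕ) : i ≤ w.n r → w.c r j - 1 ≤ w.x r i → w.x r i ≤ w.c r j + 1 →
      IsEdge (w.rowPt r i) (w.colPt r j 0)
  | col (r j s : ℕ) : s + 1 ≤ w.m r j → IsEdge (w.colPt r j s) (w.colPt r j (s + 1))
  | upp (r j i : ℕ) : i ≤ w.n (r + 1) → w.c r j - 1 ≤ w.x (r + 1) i →
      w.x (r + 1) i ≤ w.c r j + 1 → IsEdge (w.colPt r j (w.m r j)) (w.rowPt (r + 1) i)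

theorem le_xpos (r i : ℕ) : (w.x r i : ℝ) ≤ w.xpos r i := by
  have : (0 : ℝ) ≤ i / (w.n r + 1) := by positivity
  simp only [xpos]; linarith

theorem xpos_lt {r i : ℕ} (hi : i ≤ w.n r) : w.xpos r i < w.x r i + 1 := by
  have : (i : ℝ) / (w.n r + 1) < 1 := by
    rw [div_lt_one (by positivity)]
    exact_mod_cast Nat.lt_succ_of_le hi
  simp only [xpos]; linarith

theorem xpos_strictMono {r i j : ℕ} (hij : i < j) (hj : j ≤ w.n r) : w.xpos r i < w.xpos r j := by
  have h1 : (w.x r i : ℝ) ≤ w.x r j := by exact_mod_cast w.x_mono r i j hij.le hj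
  have h2 : (i : ℝ) / (w.n r + 1) < j / (w.n r + 1) := by
    gcongr
  simp only [xpos]; linarith

theorem xpos_lt_iff {r i j : ℕ} (hi : i ≤ w.n r) (hj : j ≤ w.n r) :
    w.xpos r i < w.xpos r j ↔ i < j := by
  refine ⟨fun h => ?_, fun h => w.xpos_strictMono h hj⟩
  by_contra! h'
  rcases h'.eq_or_lt with rfl | h'
  · exact lt_irrefl _ h
  · exact lt_asymm h (w.xpos_strictMono h' hi)

theorem xpos_inj {r i j : ℕ} (hi : i ≤ w.n r) (hj : j ≤ w.n r) (h : w.xpos r i = w.xpos r j) :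
    i = j := by
  rcases lt_trichotomy i j with h' | h' | h'
  · exact absurd h (w.xpos_strictMono h' hj).ne
  · exact h'
  · exact absurd h (w.xpos_strictMono h' hi).ne'

/-- The part of the plane around the `j`-th connector above row `r`, between the heights
`r + e / (m r j + 2)` and `r + (e + 1) / (m r j + 2)`. -/
def InStrip (r j e : ℕ) (z : ℝ × ℝ) : Prop :=
  (w.c r j - 1 ≤ z.1 ∧ z.1 < w.c r j + 2) ∧
    e < (z.2 - r) * (w.m r j + 2) ∧ (z.2 - r) * (w.m r j + 2) < e + 1

variable {w}

theorem InStrip.level {r j e : ℕ} {z : ℝ × ℝ} (h : w.InStrip r j e z) (he : e ≤ w.m r j + 1) :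
    (r : ℝ) < z.2 ∧ z.2 < r + 1 := by
  obtain ⟨-, h1, h2⟩ := h
  have he' : (e : ℝ) ≤ w.m r j + 1 := by exact_mod_cast he
  have he0 : (0 : ℝ) ≤ e := by positivity
  have hm : (0 : ℝ) ≤ w.m r j := by positivity
  constructor <;> nlinarith

theorem col_unique {r j j' : ℕ} {a : ℝ} (h1 : w.c r j - 1 ≤ a) (h2 : a < w.c r j + 2)
    (h1' : w.c r j' - 1 ≤ a) (h2' : a < w.c r j' + 2) : j = j' := by
  have h3 : w.c r j < w.c r j' + 3 := by
    have : (w.c r j : ℝ) < w.c r j' + 3 := by linarith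
    exact_mod_cast this
  have h4 : w.c r j' < w.c r j + 3 := by
    have : (w.c r j' : ℝ) < w.c r j + 3 := by linarith
    exact_mod_cast this
  rcases lt_trichotomy j j' with h | h | h
  · have := w.c_sep r j j' h; omega
  · exact h
  · have := w.c_sep r j' j h; omega

theorem level_unique {r r' : ℕ} {a : ℝ} (h1 : (r : ℝ) < a) (h2 : a < r + 1) (h1' : (r' : ℝ) ≤ a)
    (h2' : a < r' + 1) : r = r' := by
  have h3 : (r : ℝ) < r' + 1 := by linarith
  have h4 : (r' : ℝ) < r + 1 := by linarith
  norm_cast at h3 h4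
  omega

/-- The integer part of the height gives `r`. Strips have width 3 and `c_sep` keeps their columns 3
apart, which gives `j`; the rescaled height then gives `e`. -/
theorem InStrip.unique {r j e r' j' e' : ℕ} {z : ℝ × ℝ} (h : w.InStrip r j e z)
    (h' : w.InStrip r' j' e' z) (he : e ≤ w.m r j + 1) (he' : e' ≤ w.m r' j' + 1) :
    r = r' ∧ j = j' ∧ e = e' := by
  obtain ⟨h1, h2⟩ := h.level he
  obtain ⟨h1', h2'⟩ := h'.level he'
  obtain rfl := level_unique h1 h2 h1'.le h2'
  obtain ⟨⟨h3, h4⟩, h5, h6⟩ := h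
  obtain ⟨⟨h3', h4'⟩, h5', h6'⟩ := h'
  obtain rfl := col_unique h3 h4 h3' h4'
  refine ⟨rfl, rfl, ?_⟩
  have h7 : (e : ℝ) < e' + 1 := by linarith
  have h8 : (e' : ℝ) < e + 1 := by linarith
  norm_cast at h7 h8
  omega

theorem inStrip_low {r j i : ℕ} (hi : i ≤ w.n r) (h1 : w.c r j - 1 ≤ w.x r i)
    (h2 : w.x r i ≤ w.c r j + 1) {z : ℝ × ℝ}
    (hz : z ∈ openSegment ℝ (w.rowPt r i) (w.colPt r j 0)) : w.InStrip r j 0 z := by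
  obtain ⟨α, β, hα, hβ, hαβ, rfl⟩ := hz
  have h3 : (w.c r j : ℝ) - 1 ≤ w.x r i := by exact_mod_cast h1
  have h4 : (w.x r i : ℝ) ≤ w.c r j + 1 := by exact_mod_cast h2
  have h5 := w.le_xpos r i
  have h6 := w.xpos_lt hi
  obtain rfl : α = 1 - β := by linarith
  have hm : ((w.m r j : ℝ) + 2) ≠ 0 := by positivity
  have key : ((1 - β) * (r : ℝ) + β * (r + (0 + 1) / (w.m r j + 2)) - r) * (w.m r j + 2) = β := by
    field_simp; ring
  simp only [InStrip, rowPt, colPt, Prod.smul_mk, Prod.mk_add_mk, smul_eq_mul, Nat.cast_zero, key]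
  refine ⟨⟨?_, ?_⟩, hβ, by linarith⟩ <;> nlinarith

theorem inStrip_upp {r j i : ℕ} (hi : i ≤ w.n (r + 1)) (h1 : w.c r j - 1 ≤ w.x (r + 1) i)
    (h2 : w.x (r + 1) i ≤ w.c r j + 1) {z : ℝ × ℝ}
    (hz : z ∈ openSegment ℝ (w.colPt r j (w.m r j)) (w.rowPt (r + 1) i)) :
    w.InStrip r j (w.m r j + 1) z := by
  obtain ⟨α, β, hα, hβ, hαβ, rfl⟩ := hz
  have h3 : (w.c r j : ℝ) - 1 ≤ w.x (r + 1) i := by exact_mod_cast h1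
  have h4 : (w.x (r + 1) i : ℝ) ≤ w.c r j + 1 := by exact_mod_cast h2
  have h5 := w.le_xpos (r + 1) i
  have h6 := w.xpos_lt hi
  obtain rfl : α = 1 - β := by linarith
  have hm : ((w.m r j : ℝ) + 2) ≠ 0 := by positivity
  have key : ((1 - β) * ((r : ℝ) + (w.m r j + 1) / (w.m r j + 2)) + β * (r + 1) - r) *
      (w.m r j + 2) = w.m r j + 1 + β := by
    field_simp; ring
  simp only [InStrip, rowPt, colPt, Prod.smul_mk, Prod.mk_add_mk, smul_eq_mul, Nat.cast_add,
    Nat.cast_one, key]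
  refine ⟨⟨?_, ?_⟩, by linarith, by linarith⟩ <;> nlinarith

theorem inStrip_col {r j s : ℕ} {z : ℝ × ℝ}
    (hz : z ∈ openSegment ℝ (w.colPt r j s) (w.colPt r j (s + 1))) :
    w.InStrip r j (s + 1) z := by
  obtain ⟨α, β, hα, hβ, hαβ, rfl⟩ := hz
  obtain rfl : α = 1 - β := by linarith
  have hm : ((w.m r j : ℝ) + 2) ≠ 0 := by positivity
  have key : ((1 - β) * ((r : ℝ) + (s + 1) / (w.m r j + 2)) +
      β * (r + (s + 1 + 1) / (w.m r j + 2)) - r) * (w.m r j + 2) = s + 1 + β := by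
    field_simp; ring
  simp only [InStrip, colPt, Prod.smul_mk, Prod.mk_add_mk, smul_eq_mul, Nat.cast_add,
    Nat.cast_one, key]
  refine ⟨⟨?_, ?_⟩, by linarith, by linarith⟩ <;> nlinarith

theorem row_region {r i : ℕ} (hi : i + 1 ≤ w.n r) {z : ℝ × ℝ}
    (hz : z ∈ openSegment ℝ (w.rowPt r i) (w.rowPt r (i + 1))) :
    z.2 = r ∧ w.xpos r i < z.1 ∧ z.1 < w.xpos r (i + 1) := by
  obtain ⟨α, β, hα, hβ, hαβ, rfl⟩ := hz
  obtain rfl : α = 1 - β := by linarith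
  have := w.xpos_strictMono (Nat.lt_succ_self i) hi
  simp only [rowPt, Prod.smul_mk, Prod.mk_add_mk, smul_eq_mul]
  refine ⟨by ring, ?_, ?_⟩ <;> nlinarith

/-- An inner point of an edge lies in a row, or in a strip. -/
theorem IsEdge.region {a b z : ℝ × ℝ} (h : w.IsEdge a b) (hz : z ∈ openSegment ℝ a b) :
    (∃ r i, i + 1 ≤ w.n r ∧ a = w.rowPt r i ∧ b = w.rowPt r (i + 1) ∧ z.2 = r ∧
      w.xpos r i < z.1 ∧ z.1 < w.xpos r (i + 1)) ∨
    ∃ r j e, e ≤ w.m r j + 1 ∧ w.InStrip r j e z ∧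
      ((e = 0 ∧ ∃ i ≤ w.n r, a = w.rowPt r i ∧ b = w.colPt r j 0) ∨
        (∃ s, s + 1 ≤ w.m r j ∧ e = s + 1 ∧ a = w.colPt r j s ∧ b = w.colPt r j (s + 1)) ∨
        (e = w.m r j + 1 ∧ ∃ i ≤ w.n (r + 1), a = w.colPt r j (w.m r j) ∧
          b = w.rowPt (r + 1) i)) := by
  cases h with
  | row r i hi => exact Or.inl ⟨r, i, hi, rfl, rfl, row_region hi hz⟩
  | low r j i hi h1 h2 =>
    exact Or.inr ⟨r, j, 0, by omega, inStrip_low hi h1 h2 hz, Or.inl ⟨rfl, i, hi, rfl, rfl⟩⟩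
  | col r j s hs =>
    exact Or.inr ⟨r, j, s + 1, by omega, inStrip_col hz, Or.inr (Or.inl ⟨s, hs, rfl, rfl, rfl⟩)⟩
  | upp r j i hi h1 h2 =>
    exact Or.inr ⟨r, j, _, le_rfl, inStrip_upp hi h1 h2 hz,
      Or.inr (Or.inr ⟨rfl, i, hi, rfl, rfl⟩)⟩

/-- The end of a connector may see several row vertices, which gives a fan of segments with one
apex. Equal heights force equal parameters on two of them, and then equal abscissae force equal
feet. -/
theorem rowPt_of_mem_low {r i i' j : ℕ} (hi : i ≤ w.n r) (hi' : i' ≤ w.n r) {z : ℝ × ℝ}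
    (hz : z ∈ openSegment ℝ (w.rowPt r i) (w.colPt r j 0))
    (hz' : z ∈ openSegment ℝ (w.rowPt r i') (w.colPt r j 0)) : i = i' := by
  obtain ⟨α, β, hα, hβ, hαβ, rfl⟩ := hz
  obtain ⟨α', β', hα', hβ', hαβ', h⟩ := hz'
  obtain rfl : α = 1 - β := by linarith
  obtain rfl : α' = 1 - β' := by linarith
  simp only [rowPt, colPt, Prod.smul_mk, Prod.mk_add_mk, smul_eq_mul, Prod.mk.injEq] at h
  obtain ⟨h1, h2⟩ := h
  have hd : (0 : ℝ) < (((0 : ℕ) : ℝ) + 1) / (w.m r j + 2) := by positivity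
  obtain rfl : β' = β := by
    refine mul_right_cancel₀ hd.ne' ?_
    linarith
  refine w.xpos_inj hi hi' (mul_left_cancel₀ hα.ne' ?_)
  linarith

theorem rowPt_of_mem_upp {r i i' j : ℕ} (hi : i ≤ w.n (r + 1)) (hi' : i' ≤ w.n (r + 1))
    {z : ℝ × ℝ} (hz : z ∈ openSegment ℝ (w.colPt r j (w.m r j)) (w.rowPt (r + 1) i))
    (hz' : z ∈ openSegment ℝ (w.colPt r j (w.m r j)) (w.rowPt (r + 1) i')) : i = i' := by
  obtain ⟨α, β, hα, hβ, hαβ, rfl⟩ := hz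
  obtain ⟨α', β', hα', hβ', hαβ', h⟩ := hz'
  obtain rfl : α = 1 - β := by linarith
  obtain rfl : α' = 1 - β' := by linarith
  simp only [rowPt, colPt, Prod.smul_mk, Prod.mk_add_mk, smul_eq_mul, Prod.mk.injEq] at h
  obtain ⟨h1, h2⟩ := h
  have hd : (0 : ℝ) < 1 - (w.m r j + 1) / (w.m r j + 2) := by
    rw [sub_pos, div_lt_one (by positivity)]; linarith
  push_cast at h2
  obtain rfl : β' = β := by
    refine mul_right_cancel₀ hd.ne' ?_
    linarith
  refine w.xpos_inj hi hi' (mul_left_cancel₀ hβ.ne' ?_)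
  linarith

/-- The regions of `IsEdge.region` are pairwise disjoint and each contains a single open edge,
except for the first and last strip of a connector, which contain fans. -/
theorem IsEdge.eq_of_mem {a b a' b' z : ℝ × ℝ} (h : w.IsEdge a b) (h' : w.IsEdge a' b')
    (hz : z ∈ openSegment ℝ a b) (hz' : z ∈ openSegment ℝ a' b') : a = a' ∧ b = b' := by
  rcases h.region hz with ⟨r, i, hi, rfl, rfl, h1, h2, h3⟩ | ⟨r, j, e, he, h1, h2⟩ <;>
  rcases h'.region hz' with ⟨r', i', hi', rfl, rfl, h1', h2', h3'⟩ | ⟨r', j', e', he', h1', h2'⟩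
  · obtain rfl : r = r' := by
      rw [h1] at h1'; exact_mod_cast h1'
    have h4 := (w.xpos_lt_iff (by omega) hi').mp (h2.trans h3')
    have h5 := (w.xpos_lt_iff (by omega) hi).mp (h2'.trans h3)
    obtain rfl : i = i' := by omega
    exact ⟨rfl, rfl⟩
  · obtain ⟨h4, h5⟩ := h1'.level he'
    obtain rfl := level_unique h4 h5 h1.ge (by linarith)
    linarith
  · obtain ⟨h4, h5⟩ := h1.level he
    obtain rfl := level_unique h4 h5 h1'.ge (by linarith)
    linarith
  · obtain ⟨rfl, rfl, rfl⟩ := h1.unique h1' he he'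
    -- The index `e` determines the kind of edge: 0 is the lower fan, `m r j + 1` the upper fan, and
    -- the values between belong to the connector. Mixed cases are arithmetically impossible.
    rcases h2 with ⟨h3, i, hi, rfl, rfl⟩ | ⟨s, hs, h3, rfl, rfl⟩ | ⟨h3, i, hi, rfl, rfl⟩ <;>
    rcases h2' with ⟨h3', i', hi', rfl, rfl⟩ | ⟨s', hs', h3', rfl, rfl⟩ |
      ⟨h3', i', hi', rfl, rfl⟩ <;> try omega
    · obtain rfl := rowPt_of_mem_low hi hi' hz hz'
      exact ⟨rfl, rfl⟩
    · obtain rfl : s = s' := by omega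
      exact ⟨rfl, rfl⟩
    · obtain rfl := rowPt_of_mem_upp hi hi' hz hz'
      exact ⟨rfl, rfl⟩

theorem colPt_height (r j s : ℕ) : ((w.colPt r j s).2 - r) * (w.m r j + 2) = s + 1 := by
  have hm : ((w.m r j : ℝ) + 2) ≠ 0 := by positivity
  simp only [colPt]; field_simp; ring

theorem colPt_level {r j s : ℕ} (hs : s ≤ w.m r j) :
    (r : ℝ) < (w.colPt r j s).2 ∧ (w.colPt r j s).2 < r + 1 := by
  have h1 : (s : ℝ) ≤ w.m r j := by exact_mod_cast hs
  have h2 : ((s : ℝ) + 1) / (w.m r j + 2) < 1 := by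
    rw [div_lt_one (by positivity)]; linarith
  have h3 : 0 < ((s : ℝ) + 1) / (w.m r j + 2) := by positivity
  simp only [colPt]
  constructor <;> linarith

theorem IsVertex.notMem_openSegment {u a b : ℝ × ℝ} (hu : w.IsVertex u) (h : w.IsEdge a b) :
    u ∉ openSegment ℝ a b := by
  intro hz
  cases hu with
  | row r' i' hi' =>
    rcases h.region hz with ⟨r, i, hi, -, -, h1, h2, h3⟩ | ⟨r, j, e, he, h1, -⟩
    · simp only [rowPt, Nat.cast_inj] at h1 h2 h3
      subst h1
      have h4 := (w.xpos_lt_iff (by omega) hi').mp h2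
      have h5 := (w.xpos_lt_iff hi' hi).mp h3
      omega
    · obtain ⟨h4, h5⟩ := h1.level he
      simp only [rowPt] at h4 h5
      norm_cast at h4 h5
      omega
  | col r' j' s' hs' =>
    have hl := w.colPt_level hs'
    rcases h.region hz with ⟨r, i, hi, -, -, h1, h2, h3⟩ | ⟨r, j, e, he, h1, -⟩
    · obtain rfl := level_unique hl.1 hl.2 h1.ge (by linarith)
      linarith
    · obtain ⟨h4, h5⟩ := h1.level he
      obtain rfl := level_unique hl.1 hl.2 h4.le h5
      obtain ⟨⟨h6, h7⟩, h8, h9⟩ := h1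
      obtain rfl : j' = j := col_unique (a := (w.colPt r' j' s').1) (by simp only [colPt]; linarith)
        (by simp only [colPt]; linarith) h6 h7
      rw [colPt_height] at h8 h9
      norm_cast at h8 h9
      omega

theorem rowPt_inj {r i r' i' : ℕ} (hi : i ≤ w.n r) (hi' : i' ≤ w.n r')
    (h : w.rowPt r i = w.rowPt r' i') : r = r' ∧ i = i' := by
  simp only [rowPt, Prod.mk.injEq, Nat.cast_inj] at h
  obtain ⟨h, rfl⟩ := h
  exact ⟨rfl, w.xpos_inj hi hi' h⟩

theorem rowPt_ne_colPt {r i r' j s : ℕ} (hs : s ≤ w.m r' j) : w.rowPt r i ≠ w.colPt r' j s := by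
  intro h
  have hl := w.colPt_level hs
  rw [← h] at hl
  simp only [rowPt] at hl
  norm_cast at hl
  omega

theorem colPt_inj {r j s r' j' s' : ℕ} (hs : s ≤ w.m r j) (hs' : s' ≤ w.m r' j')
    (h : w.colPt r j s = w.colPt r' j' s') : r = r' ∧ j = j' ∧ s = s' := by
  have hl := w.colPt_level hs
  have hl' := w.colPt_level hs'
  rw [← h] at hl'
  obtain rfl := level_unique hl.1 hl.2 hl'.1.le hl'.2
  have h1 := congrArg Prod.fst h
  simp only [colPt] at h1
  obtain rfl : j = j' := col_unique (w := w) (r := r) (a := w.c r j + 1 / 2) (by linarith) (by linarith)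
    (by linarith) (by linarith)
  have h2 := w.colPt_height r j s
  rw [h, colPt_height] at h2
  refine ⟨rfl, rfl, ?_⟩
  have : (s' : ℝ) = s := by linarith
  exact_mod_cast this.symm

end WallShape

end SimpleGraph

/-! ### Shortest chains and induced walls in a square with local edges -/

namespace SimpleGraph

section Chain

variable {V : Type*}

/-- A shortest sequence of consecutively related elements from `A` to `T`. -/
structure IsShortestChain (R : V → V → Prop) (A T : Set V) (n : ℕ) (p : ℕ → V) : Prop where
  zero_mem : p 0 ∈ A
  last_mem : p n ∈ T
  rel : ∀ i < n, R (p i) (p (i + 1))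
  succ_of_rel : ∀ i j, i < j → j ≤ n → R (p i) (p j) → j = i + 1
  eq_zero_of_mem : ∀ i ≤ n, p i ∈ A → i = 0
  eq_last_of_mem : ∀ i ≤ n, p i ∈ T → i = n

theorem exists_chain_of_reflTransGen {R : V → V → Prop} {a t : V}
    (h : Relation.ReflTransGen R a t) :
    ∃ (n : ℕ) (p : ℕ → V), p 0 = a ∧ p n = t ∧ ∀ i < n, R (p i) (p (i + 1)) := by
  induction h with
  | refl => exact ⟨0, fun _ => a, rfl, rfl, by simp⟩
  | @tail b c _ hbc ih =>
    obtain ⟨n, p, h0, hn, hp⟩ := ih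
    refine ⟨n + 1, fun i => if i ≤ n then p i else c, by simpa using h0, by simp, fun i hi => ?_⟩
    by_cases hin : i < n
    · simpa [hin.le, Nat.succ_le_of_lt hin] using hp i hin
    · obtain rfl : i = n := by omega
      simpa [hn] using hbc

theorem exists_isShortestChain {R : V → V → Prop} {A T : Set V} {a t : V} (ha : a ∈ A)
    (ht : t ∈ T) (h : Relation.ReflTransGen R a t) : ∃ n p, IsShortestChain R A T n p := by
  classical
  have hex : ∃ (n : ℕ) (p : ℕ → V), p 0 ∈ A ∧ p n ∈ T ∧ ∀ i < n, R (p i) (p (i + 1)) := by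
    obtain ⟨n, p, h0, hn, hp⟩ := exists_chain_of_reflTransGen h
    exact ⟨n, p, h0 ▸ ha, hn ▸ ht, hp⟩
  obtain ⟨p, h0, hn, hp⟩ := Nat.find_spec hex
  have hmin := fun m => Nat.find_min' hex (m := m)
  generalize Nat.find hex = n at *
  refine ⟨n, p, h0, hn, hp, fun i j hij hjn hR => ?_, fun i hin hi => ?_, fun i hin hi => ?_⟩
  · by_contra hne
    -- A relation from `p i` to `p j` allows the j - i - 1 elements between them to be skipped.
    have := hmin (n - (j - i - 1)) ⟨fun s => if s ≤ i then p s else p (s + (j - i - 1)), by simpa,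
      ?_, fun s hs => ?_⟩
    · omega
    · have h1 : ¬ n - (j - i - 1) ≤ i := by omega
      have h2 : n - (j - i - 1) + (j - i - 1) = n := by omega
      simpa [h1, h2] using hn
    · rcases lt_trichotomy s i with h1 | rfl | h1
      · have h2 : s + 1 ≤ i := h1
        simpa [h1.le, h2] using hp s (by omega)
      · have h2 : s + 1 + (j - s - 1) = j := by omega
        simpa [h2] using hR
      · have h2 : ¬ s ≤ i := by omega
        have h3 : ¬ s + 1 ≤ i := by omega
        have h4 : s + 1 + (j - i - 1) = s + (j - i - 1) + 1 := by omega
        simpa [h2, h3, h4] using hp (s + (j - i - 1)) (by omega)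
  · have := hmin (n - i) ⟨fun s => p (s + i), by simpa using hi, ?_, fun s hs => ?_⟩
    · omega
    · simpa [Nat.sub_add_cancel hin] using hn
    · have h4 : s + 1 + i = s + i + 1 := by omega
      simpa [h4] using hp (s + i) (by omega)
  · have := hmin i ⟨p, h0, hi, fun s hs => hp s (by omega)⟩
    omega

end Chain

variable {V : Type*} {G : SimpleGraph V} {cx cy : V → ℤ}

theorem connected_image_of_ordConnected {p : ℕ → V} {I : Set ℕ} (hI : I.OrdConnected)
    (hne : I.Nonempty) (hadj : ∀ i, i ∈ I → i + 1 ∈ I → G.Adj (p i) (p (i + 1))) :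
    (G.induce (p '' I)).Connected := by
  have h0 := Nat.sInf_mem hne
  refine induce_connected_of_base (p (sInf I)) ⟨_, h0, rfl⟩ ?_
  rintro _ ⟨i, hi, rfl⟩
  have hle := Nat.sInf_le hi
  generalize sInf I = a at *
  induction i, hle using Nat.le_induction with
  | base => exact Relation.ReflTransGen.refl
  | succ i hai ih =>
    have hi' : i ∈ I := hI.out h0 hi ⟨hai, Nat.le_succ i⟩
    exact (ih hi').tail ⟨hadj i hi' hi, ⟨i, hi', rfl⟩, ⟨i + 1, hi, rfl⟩⟩

/-- Edges within the square `[0, N) × [0, N)` change each coordinate by at most one. -/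
def IsLocal (G : SimpleGraph V) (cx cy : V → ℤ) (N : ℤ) : Prop :=
  ∀ u v, u ∈ box cx cy 0 N 0 N → v ∈ box cx cy 0 N 0 N → G.Adj u v →
    cx v ≤ cx u + 1 ∧ cy v ≤ cy u + 1

/-- An induced path through the cells at height `y`, from left to right. -/
structure IsRow (G : SimpleGraph V) (cx cy : V → ℤ) (N y : ℤ) (n : ℕ) (p : ℕ → V) : Prop where
  mem : ∀ i ≤ n, cy (p i) = y ∧ 0 ≤ cx (p i) ∧ cx (p i) < N
  adj : ∀ i < n, G.Adj (p i) (p (i + 1))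
  mono : ∀ i j, i ≤ j → j ≤ n → cx (p i) ≤ cx (p j)
  induced : ∀ i j, i < j → j ≤ n → G.Adj (p i) (p j) → j = i + 1
  surj : ∀ x, 0 ≤ x → x < N → ∃ i ≤ n, cx (p i) = x

/-- A shortest path among those that never step back to the left is still induced: an edge from an
earlier to a later vertex also does not step back, so it would be a legal shortcut. Locality makes
the path visit every column. -/
theorem IsGridMap.exists_isRow {N : ℤ} (h : IsGridMap G cx cy N) (hloc : IsLocal G cx cy N)
    {y : ℤ} (hy : 0 ≤ y) (hyN : y < N) : ∃ n p, IsRow G cx cy N y n p := by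
  obtain ⟨u, hu⟩ := (induce_connected_iff.mp (h.connected 0 y le_rfl (by omega) hy hyN)).1
  set R : V → V → Prop := fun a b =>
    G.Adj a b ∧ cy a = y ∧ cy b = y ∧ 0 ≤ cx a ∧ cx a ≤ cx b ∧ cx b < N with hR
  have hcell : ∀ x, 0 ≤ x → x < N → ∀ a ∈ cell cx cy x y, ∀ b ∈ cell cx cy x y,
      Relation.ReflTransGen R a b := by
    intro x hx hxN a ha b hb
    refine ((induce_connected_iff.mp (h.connected x y hx hxN hy hyN)).2 a ha b hb).lift id ?_
    rintro c d ⟨hcd, ⟨rfl, rfl⟩, ⟨h3, h4⟩⟩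
    exact ⟨hcd, rfl, h4, hx, h3.ge, by rw [id, h3]; exact hxN⟩
  have hreach : ∀ x : ℕ, (x : ℤ) < N → ∀ v ∈ cell cx cy x y, Relation.ReflTransGen R u v := by
    intro x
    induction x with
    | zero => intro hx v hv; exact hcell 0 le_rfl hx u hu v hv
    | succ x ih =>
      intro hx v hv
      push_cast at hx hv
      obtain ⟨a, ha, b, hb, hab⟩ := h.right x y (by omega) hx hy hyN
      have hadj : G.Adj a b := hab.resolve_left (by
        rintro rfl
        have := ha.1.symm.trans hb.1
        omega)
      refine (ih (by omega) a ha).trans (Relation.ReflTransGen.head ⟨hadj, ha.2, hb.2, ?_⟩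
        (hcell _ (by omega) hx b hb v hv))
      rw [ha.1, hb.1]
      omega
  obtain ⟨v, hv⟩ := (induce_connected_iff.mp
    (h.connected (N - 1) y (by omega) (by omega) hy hyN)).1
  have huv := hreach (N - 1).toNat (by omega) v (by
    rwa [Int.toNat_of_nonneg (by omega : 0 ≤ N - 1)])
  obtain ⟨n, p, hp⟩ := exists_isShortestChain hu hv huv
  have hmem : ∀ i ≤ n, cy (p i) = y ∧ 0 ≤ cx (p i) ∧ cx (p i) < N := by
    intro i hi
    cases i with
    | zero =>
      obtain ⟨h1, h2⟩ := hp.zero_mem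
      exact ⟨h2, h1.ge, by omega⟩
    | succ i =>
      obtain ⟨-, -, h1, h2, h3, h4⟩ := hp.rel i hi
      exact ⟨h1, h2.trans h3, h4⟩
  have hmono : ∀ i j, i ≤ j → j ≤ n → cx (p i) ≤ cx (p j) := by
    intro i j hij
    induction j, hij using Nat.le_induction with
    | base => intro _; exact le_rfl
    | succ j _ ih => intro hj; exact (ih (by omega)).trans (hp.rel j hj).2.2.2.2.1
  have hbox : ∀ i ≤ n, p i ∈ box cx cy 0 N 0 N := by
    intro i hi
    obtain ⟨h1, h2, h3⟩ := hmem i hi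
    exact ⟨⟨h2, h3⟩, by omega, by omega⟩
  refine ⟨n, p, hmem, fun i hi => (hp.rel i hi).1, hmono, fun i j hij hj hadj => ?_,
    fun x hx hxN => ?_⟩
  · have h1 := hmem i (by omega)
    have h2 := hmem j hj
    exact hp.succ_of_rel i j hij hj ⟨hadj, h1.1, h2.1, h1.2.1, hmono i j hij.le hj, h2.2.2⟩
  -- A discrete intermediate value argument: the column starts at 0 and rises by at most one per
  -- step.
  · have key : ∀ i ≤ n, x ≤ cx (p i) → ∃ i' ≤ n, cx (p i') = x := by
      intro i
      induction i with
      | zero =>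
        intro h0 h1
        exact ⟨0, h0, by have := hp.zero_mem.1; omega⟩
      | succ i ih =>
        intro hi h1
        by_cases h2 : x ≤ cx (p i)
        · exact ih (by omega) h2
        · have := (hloc _ _ (hbox i (by omega)) (hbox (i + 1) hi) (hp.rel i hi).1).1
          exact ⟨i + 1, hi, by omega⟩
    exact key n le_rfl (by have := hp.last_mem.1; omega)

/-- An induced path within a column, from a neighbour of `P` to a neighbour of `P'`, with no other
neighbours of `P` and `P'`. -/
structure IsConnector (G : SimpleGraph V) (cx cy : V → ℤ) (x y : ℤ) (P P' : Set V) (m : ℕ)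
    (q : ℕ → V) : Prop where
  mem : ∀ s ≤ m, cx (q s) = x ∧ y ≤ cy (q s) ∧ cy (q s) ≤ y + 2
  adj : ∀ s < m, G.Adj (q s) (q (s + 1))
  induced : ∀ s s', s < s' → s' ≤ m → G.Adj (q s) (q s') → s' = s + 1
  low : ∃ u ∈ P, G.Adj u (q 0)
  upp : ∃ u ∈ P', G.Adj u (q m)
  low_only : ∀ s ≤ m, ∀ u ∈ P, G.Adj u (q s) → s = 0
  upp_only : ∀ s ≤ m, ∀ u ∈ P', G.Adj u (q s) → s = m

/-- Two minimisations are needed. The interior of a shortest path from `P` to `P'` in the column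
shows that neighbours of the two rows can be linked while avoiding both rows. A shortest such link
then sees `P` only from its first vertex and `P'` only from its last. -/
theorem IsGridMap.exists_isConnector {N : ℤ} (h : IsGridMap G cx cy N)
    (hloc : IsLocal G cx cy N) {x y : ℤ} (hx : 0 ≤ x) (hxN : x < N) (hy : 0 ≤ y)
    (hyN : y + 2 < N) {P P' : Set V} (hP : ∀ u ∈ P, cy u = y) (hP' : ∀ u ∈ P', cy u = y + 2)
    (hPx : ∃ u ∈ P, cx u = x) (hPx' : ∃ u ∈ P', cx u = x) :
    ∃ m q, IsConnector G cx cy x y P P' m q := by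
  set K := box cx cy x (x + 1) y (y + 3) with hK
  have hKc := h.box_connected hx (by omega : x < x + 1) (by omega) hy (by omega : y < y + 3)
    (by omega)
  have hKbox : K ⊆ box cx cy 0 N 0 N := by
    rintro v ⟨⟨_, _⟩, _, _⟩; refine ⟨⟨?_, ?_⟩, ?_, ?_⟩ <;> omega
  obtain ⟨u, hu, hux⟩ := hPx
  obtain ⟨v, hv, hvx⟩ := hPx'
  have huy := hP u hu
  have hvy := hP' v hv
  have huK : u ∈ K := ⟨⟨by omega, by omega⟩, by omega, by omega⟩
  have hvK : v ∈ K := ⟨⟨by omega, by omega⟩, by omega, by omega⟩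
  obtain ⟨n, p, hp⟩ := exists_isShortestChain (A := P ∩ K) (T := P' ∩ K) ⟨hu, huK⟩ ⟨hv, hvK⟩
    ((induce_connected_iff.mp hKc).2 u huK v hvK)
  have hpK : ∀ i ≤ n, p i ∈ K := by
    intro i hi
    cases i with
    | zero => exact hp.zero_mem.2
    | succ i => exact (hp.rel i hi).2.2
  -- The rows differ by 2 in height and an edge climbs at most 1, so the path has an interior
  -- vertex.
  have hn : 2 ≤ n := by
    by_contra! hn
    have h1 := hP _ hp.zero_mem.1
    have h2 := hP' _ hp.last_mem.1
    obtain rfl | rfl : n = 0 ∨ n = 1 := by omega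
    · omega
    · have := (hloc _ _ (hKbox (hpK 0 (by omega))) (hKbox (hpK 1 le_rfl)) (hp.rel 0 (by omega)).1).2
      omega
  set K' := {v | v ∈ K ∧ v ∉ P ∧ v ∉ P'} with hK'
  have hpK' : ∀ i, 0 < i → i < n → p i ∈ K' := by
    intro i h0 hi
    refine ⟨hpK i hi.le, fun hc => ?_, fun hc => ?_⟩
    · have := hp.eq_zero_of_mem i hi.le ⟨hc, hpK i hi.le⟩; omega
    · have := hp.eq_last_of_mem i hi.le ⟨hc, hpK i hi.le⟩; omega
  have hreach : ∀ i, 1 ≤ i → i < n →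
      Relation.ReflTransGen (fun a b => G.Adj a b ∧ a ∈ K' ∧ b ∈ K') (p 1) (p i) := by
    intro i h1
    induction i, h1 using Nat.le_induction with
    | base => intro _; exact Relation.ReflTransGen.refl
    | succ i h1 ih =>
      intro hi
      exact (ih (by omega)).tail ⟨(hp.rel i (by omega)).1, hpK' i h1 (by omega),
        hpK' (i + 1) (by omega) hi⟩
  obtain ⟨m, q, hq⟩ := exists_isShortestChain (A := {v | v ∈ K' ∧ ∃ u ∈ P, G.Adj u v})
    (T := {v | v ∈ K' ∧ ∃ u ∈ P', G.Adj u v})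
    ⟨hpK' 1 (by omega) (by omega), p 0, hp.zero_mem.1, (hp.rel 0 (by omega)).1⟩
    ⟨hpK' (n - 1) (by omega) (by omega), p n, hp.last_mem.1, by
      have := (hp.rel (n - 1) (by omega)).1.symm
      rwa [Nat.sub_add_cancel (by omega)] at this⟩
    (hreach (n - 1) (by omega) (by omega))
  have hqK' : ∀ i ≤ m, q i ∈ K' := by
    intro i hi
    cases i with
    | zero => exact hq.zero_mem.1
    | succ i => exact (hq.rel i hi).2.2
  refine ⟨m, q, fun s hs => ?_, fun s hs => (hq.rel s hs).1, fun s s' hss hs' hadj =>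
    hq.succ_of_rel s s' hss hs' ⟨hadj, hqK' s (by omega), hqK' s' hs'⟩,
    hq.zero_mem.2, hq.last_mem.2, fun s hs u hu hadj => hq.eq_zero_of_mem s hs ⟨hqK' s hs, u, hu,
    hadj⟩, fun s hs u hu hadj => hq.eq_last_of_mem s hs ⟨hqK' s hs, u, hu, hadj⟩⟩
  obtain ⟨⟨⟨h1, h2⟩, h3, h4⟩, -⟩ := hqK' s hs
  exact ⟨by omega, h3, by omega⟩

/-- The vertices of a wall with rows `0, …, k` and `k + 1` connectors between consecutive rows. -/
def wallSet (k : ℕ) (n : ℕ → ℕ) (m : ℕ → ℕ → ℕ) (p : ℕ → ℕ → V) (q : ℕ → ℕ → ℕ → V) : Set V :=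
  {v | (∃ r i, r ≤ k ∧ i ≤ n r ∧ v = p r i) ∨
    ∃ r j s, r < k ∧ j ≤ k ∧ s ≤ m r j ∧ v = q r j s}

theorem WallShape.isPlanar_induce (w : WallShape) {k : ℕ} {p : ℕ → ℕ → V} {q : ℕ → ℕ → ℕ → V}
    (hrow : ∀ r i r' i', r ≤ k → i ≤ w.n r → r' ≤ k → i' ≤ w.n r' → G.Adj (p r i) (p r' i') →
      r = r' ∧ (i' = i + 1 ∨ i = i' + 1))
    (hcol : ∀ r j s r' j' s', r < k → j ≤ k → s ≤ w.m r j → r' < k → j' ≤ k → s' ≤ w.m r' j' →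
      G.Adj (q r j s) (q r' j' s') → r = r' ∧ j = j' ∧ (s' = s + 1 ∨ s = s' + 1))
    (hrowcol : ∀ r i r' j s, r ≤ k → i ≤ w.n r → r' < k → j ≤ k → s ≤ w.m r' j →
      G.Adj (p r i) (q r' j s) → (w.c r' j - 1 ≤ w.x r i ∧ w.x r i ≤ w.c r' j + 1) ∧
        (r = r' ∧ s = 0 ∨ r = r' + 1 ∧ s = w.m r' j)) :
    (G.induce (wallSet k w.n w.m p q)).IsPlanar := by
  have hex : ∀ v : wallSet k w.n w.m p q, ∃ z,
      (∃ r i, r ≤ k ∧ i ≤ w.n r ∧ v.1 = p r i ∧ z = w.rowPt r i) ∨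
        ∃ r j s, r < k ∧ j ≤ k ∧ s ≤ w.m r j ∧ v.1 = q r j s ∧ z = w.colPt r j s := by
    rintro ⟨v, ⟨r, i, h1, h2, h3⟩ | ⟨r, j, s, h1, h2, h3, h4⟩⟩
    · exact ⟨_, Or.inl ⟨r, i, h1, h2, h3, rfl⟩⟩
    · exact ⟨_, Or.inr ⟨r, j, s, h1, h2, h3, h4, rfl⟩⟩
  -- Any representation of a vertex will do: the point determines the indices, so `pos` is injective
  -- even if `p` and `q` are not.
  choose pos hpos using hex
  have hinj : Function.Injective pos := by
    intro u v huv
    rcases hpos u with ⟨r, i, h1, h2, h3, h4⟩ | ⟨r, j, s, h1, h2, h3, h4, h5⟩ <;>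
    rcases hpos v with ⟨r', i', h1', h2', h3', h4'⟩ | ⟨r', j', s', h1', h2', h3', h4', h5'⟩
    · obtain ⟨rfl, rfl⟩ := WallShape.rowPt_inj h2 h2' (h4.symm.trans (huv.trans h4'))
      exact Subtype.ext (h3.trans h3'.symm)
    · exact absurd (h4.symm.trans (huv.trans h5')) (WallShape.rowPt_ne_colPt h3')
    · exact absurd (h4'.symm.trans (huv.symm.trans h5)) (WallShape.rowPt_ne_colPt h3)
    · obtain ⟨rfl, rfl, rfl⟩ := WallShape.colPt_inj h3 h3' (h5.symm.trans (huv.trans h5'))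
      exact Subtype.ext (h4.trans h4'.symm)
  have hrc : ∀ r i r' j s, r ≤ k → i ≤ w.n r → r' < k → j ≤ k → s ≤ w.m r' j →
      G.Adj (p r i) (q r' j s) → w.IsEdge (w.rowPt r i) (w.colPt r' j s) ∨
        w.IsEdge (w.colPt r' j s) (w.rowPt r i) := by
    intro r i r' j s h1 h2 h3 h4 h5 hadj
    obtain ⟨⟨h6, h7⟩, ⟨rfl, rfl⟩ | ⟨rfl, rfl⟩⟩ := hrowcol r i r' j s h1 h2 h3 h4 h5 hadj
    · exact Or.inl (.low r j i h2 h6 h7)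
    · exact Or.inr (.upp r' j i h2 h6 h7)
  refine isPlanar_of_openSegment _ pos hinj (fun u v => w.IsEdge (pos u) (pos v))
    (fun u v huv => ?_) (fun u v v' h => ?_) (fun u v u' v' z h h' hz hz' => ?_)
  · have hadj : G.Adj u.1 v.1 := huv
    rcases hpos u with ⟨r, i, h1, h2, h3, h4⟩ | ⟨r, j, s, h1, h2, h3, h4, h5⟩ <;>
    rcases hpos v with ⟨r', i', h1', h2', h3', h4'⟩ | ⟨r', j', s', h1', h2', h3', h4', h5'⟩
    · rw [h3, h3'] at hadj
      rw [h4, h4']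
      obtain ⟨rfl, rfl | rfl⟩ := hrow r i r' i' h1 h2 h1' h2' hadj
      · exact Or.inl (.row r i h2')
      · exact Or.inr (.row r i' h2)
    · rw [h3, h4'] at hadj
      rw [h4, h5']
      exact hrc r i r' j' s' h1 h2 h1' h2' h3' hadj
    · rw [h4, h3'] at hadj
      rw [h5, h4']
      exact (hrc r' i' r j s h1' h2' h1 h2 h3 hadj.symm).symm
    · rw [h4, h4'] at hadj
      rw [h5, h5']
      obtain ⟨rfl, rfl, rfl | rfl⟩ := hcol r j s r' j' s' h1 h2 h3 h1' h2' h3' hadj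
      · exact Or.inl (.col r j s h3')
      · exact Or.inr (.col r j s' h3)
  · refine WallShape.IsVertex.notMem_openSegment ?_ h
    rcases hpos u with ⟨r, i, h1, h2, h3, h4⟩ | ⟨r, j, s, h1, h2, h3, h4, h5⟩
    · rw [h4]; exact .row r i h2
    · rw [h5]; exact .col r j s h3
  · obtain ⟨h1, h2⟩ := WallShape.IsEdge.eq_of_mem h h' hz hz'
    exact ⟨hinj h1, hinj h2⟩

/-- Rows lie at heights 0, 2, …, 2k, so locality leaves no edge between different rows. The columns
split into k + 1 windows of width 6, each with one connector per level. -/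
theorem IsGridMap.exists_isPlanar_induce [Finite V] {k : ℕ}
    (h : IsGridMap G cx cy (6 * k + 6)) (hloc : IsLocal G cx cy (6 * k + 6)) :
    ∃ S : Set V, (G.induce S).IsPlanar ∧ (k : ℤ) ≤ (G.induce S).treewidth := by
  have hrows : ∀ r : ℕ, ∃ (n : ℕ) (p : ℕ → V),
      (∀ i j, i ≤ j → j ≤ n → cx (p i) ≤ cx (p j)) ∧
        (r ≤ k → IsRow G cx cy (6 * k + 6) (2 * r) n p) := by
    intro r
    by_cases hr : r ≤ k
    · obtain ⟨n, p, hp⟩ := h.exists_isRow hloc (y := 2 * r) (by omega) (by omega)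
      exact ⟨n, p, hp.mono, fun _ => hp⟩
    -- Rows above k are dummies; they are constant because `WallShape` asks for monotone columns at
    -- every level.
    · obtain ⟨⟨v, -⟩⟩ := (h.connected 0 0 le_rfl (by omega) le_rfl (by omega)).nonempty
      exact ⟨0, fun _ => v, fun _ _ _ _ => le_rfl, fun h => absurd h hr⟩
  choose n p hmono hp using hrows
  set P : ℕ → Set V := fun r => p r '' {i | i ≤ n r} with hP
  -- Connectors of consecutive levels may share a height, so their columns alternate between 1 and 4
  -- modulo 6; levels further apart are separated by height. A connector and its two adjacent
  -- columns stay inside the window [6j, 6j + 6).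
  set c : ℕ → ℕ → ℤ := fun r j => 6 * j + 1 + 3 * ((r % 2 : ℕ) : ℤ) with hc
  have hcols : ∀ r j : ℕ, ∃ (m : ℕ) (q : ℕ → V), r < k → j ≤ k →
      IsConnector G cx cy (c r j) (2 * r) (P r) (P (r + 1)) m q := by
    intro r j
    by_cases hrj : r < k ∧ j ≤ k
    · have h1 := hp r hrj.1.le
      have h2 := hp (r + 1) hrj.1
      have hx : 0 ≤ c r j ∧ c r j < 6 * k + 6 := by simp only [hc]; omega
      obtain ⟨i, hi, hix⟩ := h1.surj _ hx.1 hx.2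
      obtain ⟨i', hi', hix'⟩ := h2.surj _ hx.1 hx.2
      obtain ⟨m, q, hq⟩ := h.exists_isConnector hloc (x := c r j) (y := 2 * r) (P := P r)
        (P' := P (r + 1)) hx.1 hx.2 (by omega) (by omega)
        (by rintro _ ⟨i, hi, rfl⟩; exact (h1.mem i hi).1)
        (by rintro _ ⟨i, hi, rfl⟩; have := (h2.mem i hi).1; push_cast at this; omega)
        ⟨_, ⟨i, hi, rfl⟩, hix⟩ ⟨_, ⟨i', hi', rfl⟩, hix'⟩
      exact ⟨m, q, fun _ _ => hq⟩
    · exact ⟨0, p 0, fun h1 h2 => absurd ⟨h1, h2⟩ hrj⟩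
  choose m q hq using hcols
  let w : WallShape :=
    { n := n, m := m, x := fun r i => cx (p r i), c := c, x_mono := hmono,
      c_sep := fun r j j' hj => by simp only [hc]; omega }
  have hpbox : ∀ r i, r ≤ k → i ≤ n r → p r i ∈ box cx cy 0 (6 * k + 6) 0 (6 * k + 6) := by
    intro r i hr hi
    obtain ⟨h1, h2, h3⟩ := (hp r hr).mem i hi
    exact ⟨⟨h2, h3⟩, by omega, by omega⟩
  have hqbox : ∀ r j s, r < k → j ≤ k → s ≤ m r j →
      q r j s ∈ box cx cy 0 (6 * k + 6) 0 (6 * k + 6) := by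
    intro r j s hr hj hs
    obtain ⟨h1, h2, h3⟩ := (hq r j hr hj).mem s hs
    simp only [hc] at h1
    exact ⟨⟨by omega, by omega⟩, by omega, by omega⟩
  refine ⟨wallSet k n m p q, w.isPlanar_induce ?_ ?_ ?_, ?_⟩
  · intro r i r' i' hr hi hr' hi' hadj
    have h1 := (hloc _ _ (hpbox r i hr hi) (hpbox r' i' hr' hi') hadj).2
    have h2 := (hloc _ _ (hpbox r' i' hr' hi') (hpbox r i hr hi) hadj.symm).2
    have h3 := ((hp r hr).mem i hi).1
    have h4 := ((hp r' hr').mem i' hi').1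
    obtain rfl : r = r' := by omega
    refine ⟨rfl, ?_⟩
    rcases lt_trichotomy i i' with h5 | rfl | h5
    · exact Or.inl ((hp r hr).induced i i' h5 hi' hadj)
    · exact absurd rfl hadj.ne
    · exact Or.inr ((hp r hr).induced i' i h5 hi hadj.symm)
  · intro r j s r' j' s' hr hj hs hr' hj' hs' hadj
    have h1 := hloc _ _ (hqbox r j s hr hj hs) (hqbox r' j' s' hr' hj' hs') hadj
    have h2 := hloc _ _ (hqbox r' j' s' hr' hj' hs') (hqbox r j s hr hj hs) hadj.symm
    obtain ⟨h3, h4, h5⟩ := (hq r j hr hj).mem s hs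
    obtain ⟨h3', h4', h5'⟩ := (hq r' j' hr' hj').mem s' hs'
    simp only [hc] at h3 h3'
    obtain rfl : r = r' := by omega
    obtain rfl : j = j' := by omega
    refine ⟨rfl, rfl, ?_⟩
    rcases lt_trichotomy s s' with h6 | rfl | h6
    · exact Or.inl ((hq r j hr hj).induced s s' h6 hs' hadj)
    · exact absurd rfl hadj.ne
    · exact Or.inr ((hq r j hr hj).induced s' s h6 hs hadj.symm)
  · intro r i r' j s hr hi hr' hj hs hadj
    have h1 := hloc _ _ (hpbox r i hr hi) (hqbox r' j s hr' hj hs) hadj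
    have h2 := hloc _ _ (hqbox r' j s hr' hj hs) (hpbox r i hr hi) hadj.symm
    obtain ⟨h3, h4, h5⟩ := (hq r' j hr' hj).mem s hs
    obtain ⟨h6, -⟩ := (hp r hr).mem i hi
    refine ⟨⟨?_, ?_⟩, ?_⟩
    · show c r' j - 1 ≤ cx (p r i)
      omega
    · show cx (p r i) ≤ c r' j + 1
      omega
    · obtain rfl | rfl : r = r' ∨ r = r' + 1 := by omega
      · exact Or.inl ⟨rfl, (hq r j hr' hj).low_only s hs _ ⟨i, hi, rfl⟩ hadj⟩
      · exact Or.inr ⟨rfl, (hq r' j hr' hj).upp_only s hs _ ⟨i, hi, rfl⟩ hadj⟩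
  -- The vertical set of window j consists of the part of every row in the window and all connectors
  -- there. Monotonicity makes each part of a row an interval of its path, hence connected.
  · set Pw : ℕ → ℕ → Set V := fun j r =>
      p r '' {i | i ≤ n r ∧ 6 * (j : ℤ) ≤ cx (p r i) ∧ cx (p r i) < 6 * j + 6} with hPw
    set Qw : ℕ → ℕ → Set V := fun j r => q r j '' {s | s ≤ m r j} with hQw
    set Z : ℕ → ℕ → Set V := fun j r =>
      {v | (∃ r' ≤ r, v ∈ Pw j r') ∨ ∃ r' < r, v ∈ Qw j r'} with hZ
    have hPc : ∀ r ≤ k, (G.induce (P r)).Connected := fun r hr =>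
      connected_image_of_ordConnected Set.ordConnected_Iic ⟨0, Nat.zero_le _⟩
        fun i _ hi => (hp r hr).adj i hi
    have hPwc : ∀ j ≤ k, ∀ r ≤ k, (G.induce (Pw j r)).Connected := by
      intro j hj r hr
      refine connected_image_of_ordConnected ⟨?_⟩ ?_ fun i _ hi => (hp r hr).adj i hi.1
      · rintro a ⟨ha1, ha2, ha3⟩ b ⟨hb1, hb2, hb3⟩ i ⟨hai, hib⟩
        exact ⟨hib.trans hb1, ha2.trans (hmono r a i hai (hib.trans hb1)),
          (hmono r i b hib hb1).trans_lt hb3⟩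
      · obtain ⟨i, hi, hix⟩ := (hp r hr).surj (6 * j) (by omega) (by omega)
        exact ⟨i, hi, by omega, by omega⟩
    have hQwc : ∀ j ≤ k, ∀ r < k, (G.induce (Qw j r)).Connected := fun j hj r hr =>
      connected_image_of_ordConnected Set.ordConnected_Iic ⟨0, Nat.zero_le _⟩
        fun s _ hs => (hq r j hr hj).adj s hs
    -- Row vertices to which a connector attaches are at most one column away, so the attachment
    -- takes place inside the window.
    have hwin : ∀ r j s, r < k → j ≤ k → s ≤ m r j → ∀ r' ≤ k, ∀ u ∈ P r', G.Adj u (q r j s) →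
        u ∈ Pw j r' := by
      rintro r j s hr hj hs r' hr' _ ⟨i, hi, rfl⟩ hadj
      have h1 := hloc _ _ (hpbox r' i hr' hi) (hqbox r j s hr hj hs) hadj
      have h2 := hloc _ _ (hqbox r j s hr hj hs) (hpbox r' i hr' hi) hadj.symm
      obtain ⟨h3, h4, h5⟩ := (hq r j hr hj).mem s hs
      simp only [hc] at h3
      exact ⟨i, ⟨hi, by omega, by omega⟩, rfl⟩
    have hZc : ∀ j ≤ k, ∀ r ≤ k, (G.induce (Z j r)).Connected := by
      intro j hj r
      induction r with
      | zero =>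
        intro _
        have : Z j 0 = Pw j 0 := by
          ext v
          simp [hZ]
        rw [this]
        exact hPwc j hj 0 (Nat.zero_le _)
      | succ r ih =>
        intro hr
        have hunion : Z j (r + 1) = Z j r ∪ (Qw j r ∪ Pw j (r + 1)) := by
          ext v
          constructor
          · rintro (⟨r', hr', hv⟩ | ⟨r', hr', hv⟩)
            · rcases hr'.eq_or_lt with rfl | hr''
              · exact Or.inr (Or.inr hv)
              · exact Or.inl (Or.inl ⟨r', by omega, hv⟩)
            · rcases (Nat.lt_succ_iff.mp hr').eq_or_lt with rfl | hr''
              · exact Or.inr (Or.inl hv)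
              · exact Or.inl (Or.inr ⟨r', hr'', hv⟩)
          · rintro ((⟨r', hr', hv⟩ | ⟨r', hr', hv⟩) | hv | hv)
            · exact Or.inl ⟨r', by omega, hv⟩
            · exact Or.inr ⟨r', by omega, hv⟩
            · exact Or.inr ⟨r, by omega, hv⟩
            · exact Or.inl ⟨r + 1, le_rfl, hv⟩
        rw [hunion]
        obtain ⟨u, hu, hadj⟩ := (hq r j hr hj).low
        obtain ⟨u', hu', hadj'⟩ := (hq r j hr hj).upp
        refine Touch.connected_union ?_ (ih (by omega)) (Touch.connected_union ?_
          (hQwc j hj r hr) (hPwc j hj (r + 1) hr))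
        · exact ⟨u, Or.inl ⟨r, le_rfl, hwin r j 0 hr hj (Nat.zero_le _) r (by omega) u hu hadj⟩,
            q r j 0, Or.inl ⟨0, Nat.zero_le _, rfl⟩, Or.inr hadj⟩
        · exact ⟨q r j (m r j), ⟨_, le_refl (m r j), rfl⟩, u',
            hwin r j _ hr hj le_rfl (r + 1) hr u' hu' hadj', Or.inr hadj'.symm⟩
    have hZx : ∀ j ≤ k, ∀ v ∈ Z j k, 6 * (j : ℤ) ≤ cx v ∧ cx v < 6 * j + 6 := by
      rintro j hj _ (⟨r, hr, i, hi, rfl⟩ | ⟨r, hr, s, hs, rfl⟩)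
      · exact hi.2
      · have := ((hq r j hr hj).mem s hs).1
        simp only [hc] at this
        omega
    have := le_treewidth_induce_of_crossing (G := G) (n := k + 1) (S := wallSet k n m p q)
      (fun r => P r) (fun j => Z j k) (fun r => ?_) (fun j => ?_) (fun r => hPc r (by omega))
      (fun j => hZc j (by omega) k le_rfl) (fun r r' hrr => ?_) (fun j j' hjj => ?_)
      (fun r j => ?_)
    · push_cast at this; omega
    · rintro _ ⟨i, hi, rfl⟩
      exact Or.inl ⟨r, i, by omega, hi, rfl⟩
    · rintro _ (⟨r, hr, i, hi, rfl⟩ | ⟨r, hr, s, hs, rfl⟩)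
      · exact Or.inl ⟨r, i, hr, hi.1, rfl⟩
      · exact Or.inr ⟨r, j, s, hr, by omega, hs, rfl⟩
    · rw [Set.disjoint_left]
      rintro _ ⟨i, hi, rfl⟩ ⟨i', hi', he⟩
      have h1 := ((hp r (by omega)).mem i hi).1
      have h2 := ((hp r' (by omega)).mem i' hi').1
      rw [he] at h2
      exact hrr (Fin.ext (by omega))
    · rw [Set.disjoint_left]
      intro v hv hv'
      have h1 := hZx j (by omega) v hv
      have h2 := hZx j' (by omega) v hv'
      exact hjj (Fin.ext (by omega))
    · obtain ⟨i, hi, hix⟩ := (hp r (by omega)).surj (6 * j) (by omega) (by omega)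
      exact ⟨p r i, ⟨i, hi, rfl⟩, Or.inl ⟨r, by omega, i, ⟨hi, by omega, by omega⟩, rfl⟩⟩

end SimpleGraph

/-! ### From a grid minor to the dichotomy -/

namespace SimpleGraph

variable {V : Type*} {G : SimpleGraph V} {cx cy : V → ℤ}

theorem cell_sub (a b x y : ℤ) :
    cell (fun v => cx v - a) (fun v => cy v - b) x y = cell cx cy (x + a) (y + b) := by
  ext v
  simp only [cell, Set.mem_ofPred_eq, sub_eq_iff_eq_add]

theorem IsGridMap.sub {N : ℤ} (h : IsGridMap G cx cy N) {M a b : ℤ} (ha : 0 ≤ a)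
    (ha' : a + M ≤ N) (hb : 0 ≤ b) (hb' : b + M ≤ N) :
    IsGridMap G (fun v => cx v - a) (fun v => cy v - b) M where
  connected x y h1 h2 h3 h4 := by
    rw [cell_sub]
    exact h.connected _ _ (by omega) (by omega) (by omega) (by omega)
  right x y h1 h2 h3 h4 := by
    rw [cell_sub, cell_sub, add_right_comm]
    exact h.right _ _ (by omega) (by omega) (by omega) (by omega)
  up x y h1 h2 h3 h4 := by
    rw [cell_sub, cell_sub, add_right_comm]
    exact h.up _ _ (by omega) (by omega) (by omega) (by omega)

/-- An edge violating locality jumps over a column or, after exchanging the coordinates, over a row.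
-/
theorem IsGridMap.isLocal_of_not_crossing {N : ℤ} (h : IsGridMap G cx cy N) {M a b : ℤ}
    (ha : 0 ≤ a) (ha' : a + M ≤ N) (hb : 0 ≤ b) (hb' : b + M ≤ N)
    (hX : ¬ ∃ X Y, IsCrossing G cx cy M a b X Y ∧ Disjoint X Y) :
    IsLocal G (fun v => cx v - a) (fun v => cy v - b) M := by
  rintro u v ⟨⟨h1, h2⟩, h3, h4⟩ ⟨⟨h5, h6⟩, h7, h8⟩ huv
  by_contra hcon
  dsimp only at h1 h2 h3 h4 h5 h6 h7 h8 hcon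
  apply hX
  have hu : u ∈ box cx cy a (a + M) b (b + M) := ⟨⟨by omega, by omega⟩, by omega, by omega⟩
  have hv : v ∈ box cx cy a (a + M) b (b + M) := ⟨⟨by omega, by omega⟩, by omega, by omega⟩
  by_cases hx : cx u + 2 ≤ cx v
  · exact h.exists_isCrossing_of_jump ha ha' hb hb' huv hu hv hx
  · obtain ⟨X, Y, hXY, hd⟩ := h.swap.exists_isCrossing_of_jump hb hb' ha ha' huv
      (by rwa [box_swap]) (by rwa [box_swap]) (by omega)
    exact ⟨Y, X, hXY.swap, hd.symm⟩

theorem IsMinor.exists_isGridMap {N : ℕ} (h : (gridGraph N N).IsMinor G) :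
    ∃ cx cy : V → ℤ, IsGridMap G cx cy N := by
  classical
  obtain ⟨B, hB, hd, hadj⟩ := h
  have huniq : ∀ v w w', v ∈ B w → v ∈ B w' → w = w' := by
    intro v w w' h1 h2
    by_contra hne
    exact Set.disjoint_left.mp (hd w w' hne) h1 h2
  -- Vertices outside all branch sets are sent to (-1, -1), so that they lie in no cell of the grid.
  have hex : ∀ v, ∃ z : ℤ × ℤ, (∀ w, v ∈ B w → z = (((w.1 : ℕ) : ℤ), ((w.2 : ℕ) : ℤ))) ∧
      ((∀ w, v ∉ B w) → z = (-1, -1)) := by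
    intro v
    by_cases hv : ∃ w, v ∈ B w
    · obtain ⟨w, hw⟩ := hv
      exact ⟨(((w.1 : ℕ) : ℤ), ((w.2 : ℕ) : ℤ)), fun w' hw' => by rw [huniq v w w' hw hw'],
        fun h => absurd hw (h w)⟩
    · push Not at hv
      exact ⟨(-1, -1), fun w hw => absurd hw (hv w), fun _ => rfl⟩
  choose c hc hc' using hex
  have hcell : ∀ (x y : ℕ) (hx : x < N) (hy : y < N),
      cell (fun v => (c v).1) (fun v => (c v).2) x y = B (⟨x, hx⟩, ⟨y, hy⟩) := by
    intro x y hx hy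
    ext v
    constructor
    · rintro ⟨h1, h2⟩
      by_cases hv : ∃ w, v ∈ B w
      · obtain ⟨w, hw⟩ := hv
        have h3 := hc v w hw
        simp only [h3, Nat.cast_inj] at h1 h2
        convert hw
        exacts [h1.symm, h2.symm]
      · push Not at hv
        simp only [hc' v hv] at h1
        omega
    · intro hv
      have h3 := hc v _ hv
      simp [cell, h3]
  refine ⟨fun v => (c v).1, fun v => (c v).2, ⟨?_, ?_, ?_⟩⟩
  · intro x y h1 h2 h3 h4
    lift x to ℕ using h1
    lift y to ℕ using h3
    rw [hcell x y (by omega) (by omega)]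
    exact hB _
  · intro x y h1 h2 h3 h4
    lift x to ℕ using h1
    lift y to ℕ using h3
    have := hcell (x + 1) y (by omega) (by omega)
    push_cast at this
    rw [hcell x y (by omega) (by omega), this]
    obtain ⟨a, ha, b, hb, hab⟩ := hadj (⟨x, by omega⟩, ⟨y, by omega⟩)
      (⟨x + 1, by omega⟩, ⟨y, by omega⟩) (by simp [gridGraph, boxProd_adj, pathGraph_adj])
    exact ⟨a, ha, b, hb, Or.inr hab⟩
  · intro x y h1 h2 h3 h4
    lift x to ℕ using h1
    lift y to ℕ using h3
    have := hcell x (y + 1) (by omega) (by omega)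
    push_cast at this
    rw [hcell x y (by omega) (by omega), this]
    obtain ⟨a, ha, b, hb, hab⟩ := hadj (⟨x, by omega⟩, ⟨y, by omega⟩)
      (⟨x, by omega⟩, ⟨y + 1, by omega⟩) (by simp [gridGraph, boxProd_adj, pathGraph_adj])
    exact ⟨a, ha, b, hb, Or.inr hab⟩

end SimpleGraph

theorem theorem1 :
    ∃ (f : ℕ → ℕ → ℕ) (C : ℕ),
      (∀ k t : ℕ, 1 ≤ k → f k t ≤ C * (k * t)) ∧
      ∀ (k t : ℕ) {V : Type*} [Finite V] (G : SimpleGraph V),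
        (SimpleGraph.gridGraph (f k t) (f k t)).IsMinor G →
          (SimpleGraph.completeGraph (Fin t)).IsMinor G ∨
          ∃ S : Set V, (G.induce S).IsPlanar ∧ (k : ℤ) ≤ (G.induce S).treewidth := by
  -- Each of t blocks consists of a square of side 6k + 6 and one separating line; 6k + 7 ≤ 13k for
  -- k ≥ 1.
  refine ⟨fun k t => t * (6 * k + 7), 13, fun k t hk => by nlinarith [Nat.zero_le t],
    fun k t V _ G hG => ?_⟩
  obtain ⟨cx, cy, h⟩ := hG.exists_isGridMap
  have hN : ((t * (6 * k + 7) : ℕ) : ℤ) = t * ((6 * k + 6 : ℤ) + 1) := by push_cast; ring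
  rw [hN] at h
  by_cases hcross : ∀ i j : ℤ, 0 ≤ i → i < t → 0 ≤ j → j < t → ∃ X Y,
      SimpleGraph.IsCrossing G cx cy (6 * k + 6) (j * ((6 * k + 6 : ℤ) + 1))
        (i * ((6 * k + 6 : ℤ) + 1)) X Y ∧ Disjoint X Y
  · exact Or.inl (h.completeGraph_isMinor (by omega) hcross)
  · right
    simp only [not_forall] at hcross
    obtain ⟨i, j, hi, hit, hj, hjt, hX⟩ := hcross
    have h1 : ∀ i : ℤ, 0 ≤ i → 0 ≤ i * ((6 * k + 6 : ℤ) + 1) := fun i hi => by positivity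
    have h2 : ∀ i : ℤ, i < t →
        i * ((6 * k + 6 : ℤ) + 1) + (6 * k + 6) ≤ t * ((6 * k + 6 : ℤ) + 1) :=
      fun i hi => by nlinarith
    exact (h.sub (h1 j hj) (h2 j hjt) (h1 i hi) (h2 i hit)).exists_isPlanar_induce
      (h.isLocal_of_not_crossing (h1 j hj) (h2 j hjt) (h1 i hi) (h2 i hit) hX)
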